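/- Let $q$ be a prime power. Let $U$ be a $3$-dimensional vector space over $\mathbb F_{q^6}$ and let $PG(9,q^2)$ be the projective space of the $10$-dimensional $\mathbb F_{q^2}$-space $U\times\mathbb F_{q^2}$. Let $\Sigma$ be its hyperplane $U\times 0$ and let $\mathcal S$ be the desarguesian $2$-spread of $\Sigma$ whose elements are the $1$-dimensional $\mathbb F_{q^6}$-subspaces of $U$. Let $\Pi_3\cong PG(3,q^6)$ be the Barlotti–Cofman representation. Its points are the points of $PG(9,q^2)\setminus\Sigma$ and the elements of $\mathcal S$. Its hyperplanes are $\Sigma$ (representing the plane formed by all elements of $\mathcal S$) and the $6$-dimensional subspaces of $PG(9,q^2)$ that meet $\Sigma$ in the span of two elements of $\mathcal S$. For a set $A$ of points of $PG(9,q^2)$, the corresponding set of points of $\Pi_3$ is $(A\setminus\Sigma)\cup\{Z\in\mathcal S: Z\cap A\neq\emptyset\}$. For a point $v$, the cone $\mathfrak K(v,A)$ is the union of the subspaces $\langle v,a\rangle$, $a\in A$. Let $X,X'\in\mathcal S$ and let $p$ be a point of $X$. Let $\Gamma\subset\Sigma$ be a $7$-dimensional subspace with $X'\subseteq\Gamma$,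 $p\notin\Gamma$, and let $\Gamma'$ be an $8$-dimensional subspace of $PG(9,q^2)$ with $\Gamma'\cap\Sigma=\Gamma$. Let $\Gamma\cap X=\langle r,\tilde q\rangle$ for points $r,\tilde q$. Put $$\mathfrak H=\{\langle S_6,p\rangle : S_6\text{ is a hyperplane of }\Pi_3\text{ not containing }X\}.$$ Let $t\in X'$ be a point, let $\pi\subseteq\Gamma'$ be a plane with $\pi\cap\Sigma=\langle t,\tilde q\rangle$, and let $V$ be a Baer subplane of $\pi$ with $V\cap\langle t,\tilde q\rangle=\{\tilde q\}$. Let $L$ be a line of $\pi$ through $t$ with $|L\cap V|=q+1$, let $s\in V\cap L$, and put $$\bar B=\mathfrak K\bigl(r,(V\setminus L)\cup\{s\}\bigr).$$ Call a point $y\in X'$, $y\neq t$, exceptional if $\langle p,Z\rangle\cap\langle t,r\rangle\neq\emptyset$ for every $Z\in\mathcal S$ with $Z\subset\langle X,X'\rangle$ and $y\in\langle p,Z\rangle$. Let $L_1,L_2,L_3$ be lines of $X'$ with $L_1\cap L_2\cap L_3=\emptyset$, none of which contains $t$ or an exceptional point. Let $h\in\Gamma'\setminus\Sigma$ be a point with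 $h\notin\langle X,X',V\rangle$, and put $$\tilde B=\mathfrak K(h,L_1\cup L_2\cup L_3)\setminus\Sigma .$$ Then $\bar B\cup\tilde B\subseteq\Gamma'$. The set $(\bar B\cup\tilde B)\setminus X$ meets every element of $\mathfrak H$, is minimal with respect to inclusion among the point sets with this property, and is not contained in any plane of $PG(9,q^2)$. Moreover, the set of points of $\Pi_3$ corresponding to the cone $\mathfrak K(p,\bar B\cup\tilde B)$ is, in $PG(3,q^6)$, a point set that meets every plane, is minimal with this property, and is not contained in any plane. -/

import Mathlib

open scoped LinearAlgebra.Projectivization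

namespace BarlottiCofman

section Projective

variable {𝕜 W : Type*} [Field 𝕜] [AddCommGroup W] [Module 𝕜 W]

/-- The set of points of the projective subspace given by the vector subspace `S`
(a vector subspace of dimension `d + 1` is a projective subspace of dimension `d`). -/
def points (S : Submodule 𝕜 W) : Set (ℙ 𝕜 W) := {P | P.submodule ≤ S}

/-- The projective subspace generated by a set of points. -/
def spanPoints (A : Set (ℙ 𝕜 W)) : Submodule 𝕜 W := ⨆ P ∈ A, P.submodule

/-- The cone with vertex the point `v` and base `A`: the union of the subspaces joining `v`
to the points of `A`. -/
def cone (v : ℙ 𝕜 W) (A : Set (ℙ 𝕜 W)) : Set (ℙ 𝕜 W) :=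
  {P | ∃ Q ∈ A, P.submodule ≤ v.submodule ⊔ Q.submodule}

/-- `B` is a blocking set with respect to the family `𝓕` of subspaces. -/
def IsBlocking (𝓕 : Set (Submodule 𝕜 W)) (B : Set (ℙ 𝕜 W)) : Prop :=
  ∀ S ∈ 𝓕, (B ∩ points S).Nonempty

/-- `B` is a blocking set with respect to `𝓕`, minimal with respect to inclusion. -/
def IsMinimalBlocking (𝓕 : Set (Submodule 𝕜 W)) (B : Set (ℙ 𝕜 W)) : Prop :=
  Minimal (IsBlocking 𝓕) B

/-- `B` is contained in no (two-dimensional) plane of the projective space. -/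
def IsNonPlanar (B : Set (ℙ 𝕜 W)) : Prop :=
  ∀ S : Submodule 𝕜 W, Module.finrank 𝕜 S = 3 → ¬ B ⊆ points S

/-- `V` is a Baer subplane of the plane `π`: for a field `𝕜` that is a quadratic extension of `k`,
the points of `π` that have coordinates in `k` with respect to some basis of `π`. -/
def IsBaerSubplane (k : Type*) [Field k] [Algebra k 𝕜] (π : Submodule 𝕜 W)
    (V : Set (ℙ 𝕜 W)) : Prop :=
  ∃ b : Fin 3 → W, LinearIndependent 𝕜 b ∧ Submodule.span 𝕜 (Set.range b) = π ∧
    V = {P | ∃ a : Fin 3 → k, a ≠ 0 ∧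
      P.submodule = Submodule.span 𝕜 {∑ i, algebraMap k 𝕜 (a i) • b i}}

end Projective

section Representation

/- `K` is a cubic extension of `F` and `U` is a three-dimensional `K`-space. The projective space of
the `F`-space `U × F` is `PG(9, |F|)`, and `U × 0` is its hyperplane `Σ`. -/
variable (F K U : Type*) [Field F] [Field K] [Algebra F K] [AddCommGroup U] [Module K U]
  [Module F U] [IsScalarTower F K U]

/-- The hyperplane `Σ` of the projective space of `U × F`. -/
def infinity (F U : Type*) [Field F] [AddCommGroup U] [Module F U] : Submodule F (U × F) :=
  LinearMap.range (LinearMap.inl F U F)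

variable {K U} in
/-- The subspace of `Σ` given by a `K`-subspace of `U`. -/
def atInfinity (Y : Submodule K U) : Submodule F (U × F) :=
  (Y.restrictScalars F).map (LinearMap.inl F U F)

/-- The desarguesian spread of `Σ`: its elements are the `K`-lines of `U`, seen as
`F`-subspaces. -/
def spread : Set (Submodule F (U × F)) :=
  {Z | ∃ Y : Submodule K U, Module.finrank K Y = 1 ∧ Z = atInfinity F Y}

/-- The hyperplanes (planes) of `Π₃`, as subspaces of the projective space of `U × F`: the
hyperplane `PG(𝒮)`, which is represented by `Σ`, and the six-dimensional projective subspaces that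
meet `Σ` in a line of `PG(𝒮)`, that is in the span of two elements of the spread. -/
def hyperplanes : Set (Submodule F (U × F)) :=
  {T | T = infinity F U ∨ (Module.finrank F T = 7 ∧
    ∃ Y : Submodule K U, Module.finrank K Y = 2 ∧ T ⊓ infinity F U = atInfinity F Y)}

/-- The family `ℌ` of the subspaces `⟨S₆, p⟩`, where `S₆` is a hyperplane of `Π₃` not
containing `X`. -/
def familyH (X : Submodule F (U × F)) (p : ℙ F (U × F)) : Set (Submodule F (U × F)) :=
  {S | ∃ T ∈ hyperplanes F K U, ¬ X ≤ T ∧ S = T ⊔ p.submodule}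

/-- The points `y ≠ t` of `X'` such that every spread element `Z` in `⟨X, X'⟩` with
`y ∈ ⟨p, Z⟩` satisfies `⟨p, Z⟩ ∩ ⟨t, r⟩ ≠ ∅`. -/
def exceptionalPoints (X X' : Submodule F (U × F)) (p t r : ℙ F (U × F)) :
    Set (ℙ F (U × F)) :=
  {y | y ∈ points X' ∧ y ≠ t ∧ ∀ Z ∈ spread F K U, Z ≤ X ⊔ X' →
    y ∈ points (p.submodule ⊔ Z) →
      (points (p.submodule ⊔ Z) ∩ points (t.submodule ⊔ r.submodule)).Nonempty}

/-- The inclusion of `U × F` into the four-dimensional `K`-space `U × K`. -/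
def inclusion : (U × F) →ₛₗ[algebraMap F K] (U × K) where
  toFun x := (x.1, algebraMap F K x.2)
  map_add' x y := by simp
  map_smul' c x := by simp [Algebra.smul_def]

theorem inclusion_injective : Function.Injective (inclusion F K U) := by
  rintro ⟨u, a⟩ ⟨v, b⟩ h
  simpa [inclusion] using h

/-- The Barlotti-Cofman correspondence between the points of `PG(9, |F|)` and the points of
`PG(3, |K|)`. It is injective on the points outside `Σ`, and it sends a point of `Σ` to the point
of the hyperplane `U × 0` that corresponds to the spread element through it. So the image of a set
`A` consists of the points of `A` outside `Σ` and of the spread elements that meet `A`. -/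
def toPG3 : ℙ F (U × F) → ℙ K (U × K) :=
  Projectivization.map (inclusion F K U) (inclusion_injective F K U)

end Representation

/-- The set of all planes of a projective space; in a three-dimensional one these are the
hyperplanes. -/
def planes (K E : Type*) [Field K] [AddCommGroup E] [Module K E] : Set (Submodule K E) :=
  {M | Module.finrank K M = 3}

/-- The modified Baer cone `𝔎(r, (V ∖ L) ∪ {s})`. -/
def barB {F E : Type*} [Field F] [AddCommGroup E] [Module F E] (r : ℙ F E) (V : Set (ℙ F E))
    (L : Submodule F E) (s : ℙ F E) : Set (ℙ F E) :=
  cone r ((V \ points L) ∪ {s})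

/-- The cone `𝔎(h, L₁ ∪ L₂ ∪ L₃)` without its points in `Σ`. -/
def tildeB {F U : Type*} [Field F] [AddCommGroup U] [Module F U] (h : ℙ F (U × F))
    (L : Fin 3 → Submodule F (U × F)) : Set (ℙ F (U × F)) :=
  cone h (⋃ i, points (L i)) \ points (infinity F U)

end BarlottiCofman

/-!
The points of `(B̄ ∪ B̃) ∖ X` all lie outside `Σ`: the points of `B̄` in `Σ` are on the line
`r q̃` of `X`. So they can be identified with vectors of `U`. Let `p = F x₀`, so that `X = K x₀`, and
`t = F x₁`, so that `X' = K x₁`, and let `r = F (ρ x₀)` and `q̃ = F (θ x₀)`. Then `1, ρ, θ` is a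
basis of `K` over `F`, because `p` is not on the line `r q̃`. The affine set is the union of the
lines of direction `ρ x₀` through a set `V₀` of affine points (those of `(V ∖ L) ∪ {s}`) and of
the points `h₀ + l x₁`, where `l` runs through three two-dimensional `F`-subspaces of `K` without
a common nonzero vector. The affine parts of the elements of `ℌ` are the sets `{u | φ u ∈ κ + F}`,
where `κ ∈ K` and `φ : U → K` is a `K`-linear functional with `φ x₀ = 1`.

Blocking (`exists_mem_affineUnion`): if `φ x₁ = 0`, the condition for a line of direction `ρ x₀`
to meet the element of `ℌ` is that `φ u - κ ∈ F + F ρ`. This defines a line of `π` through `t`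
other than `t q̃`, and such a line meets `(V ∖ L) ∪ {s}`. If `φ x₁ ≠ 0`, one of the three
subspaces does not contain `(φ x₁)⁻¹`, and this yields a point of the second part.

Minimality (`exists_tangent_affineUnion`): through a point of the first part there is an element
of `ℌ` with `φ x₁ = 0` that misses the second part, and it has no other point in the first part
because a line through `t` other than `L` and `t q̃` is tangent to `V`. For a point `h₀ + l x₁`,
choose `φ x₁ = y⁻¹`, where the line `l + F y` of `K` has only `l` in common with the three
subspaces (`exists_direction`). If moreover `y⁻¹ ∉ F + F ρ`, which is what being nonexceptional
means, the line of `π` defined by `φ` meets `t q̃` in a point other than `t` and `q̃`. The value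
of `φ` at a point of `V ∩ L` is still free, and it can be chosen such that this line is a tangent
of `V` at a point of `L` other than `s` (`IsBaerSubplane.exists_tangent_line`), so that the first
part is missed. This uses that `h` is not in `⟨X, X', V⟩`.

The image of the cone in the projective space of `U × K` consists of the point `K x₀` at infinity
and of the affine points `b + f x₀`, where `b` is in the affine set and `f ∈ F`. A plane not
through `K x₀` has an equation `φ u = κ` with `φ x₀ = 1`, so the two properties carry over
(`isMinimalBlocking_coneImage`); the tangent plane at `K x₀` is the plane at infinity.
-/

namespace BarlottiCofman

/-! ### Points, lines and Baer subplanes -/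

section Points

variable {𝕜 W : Type*} [Field 𝕜] [AddCommGroup W] [Module 𝕜 W]

theorem exists_submodule_eq_span (P : ℙ 𝕜 W) : ∃ v : W, v ≠ 0 ∧ P.submodule = 𝕜 ∙ v :=
  ⟨P.rep, P.rep_nonzero, P.submodule_eq⟩

theorem point_ext {P Q : ℙ 𝕜 W} (h : P.submodule = Q.submodule) : P = Q :=
  Projectivization.submodule_injective h

theorem point_eq_of_le {P Q : ℙ 𝕜 W} (h : P.submodule ≤ Q.submodule) : P = Q := by
  apply point_ext
  have : FiniteDimensional 𝕜 Q.submodule := by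
    rw [Q.submodule_eq]; infer_instance
  exact Submodule.eq_of_le_of_finrank_eq h (by simp [Projectivization.finrank_submodule])

theorem mem_points {P : ℙ 𝕜 W} {S : Submodule 𝕜 W} : P ∈ points S ↔ P.submodule ≤ S := Iff.rfl

theorem mk_mem_points {v : W} (hv : v ≠ 0) {S : Submodule 𝕜 W} :
    Projectivization.mk 𝕜 v hv ∈ points S ↔ v ∈ S := by
  rw [mem_points, Projectivization.submodule_mk, Submodule.span_singleton_le_iff_mem]

theorem finrank_sup_of_ne {P Q : ℙ 𝕜 W} (h : P ≠ Q) :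
    Module.finrank 𝕜 (P.submodule ⊔ Q.submodule : Submodule 𝕜 W) = 2 := by
  have : FiniteDimensional 𝕜 Q.submodule := by rw [Q.submodule_eq]; infer_instance
  have : FiniteDimensional 𝕜 P.submodule := by rw [P.submodule_eq]; infer_instance
  have h1 := Submodule.finrank_sup_add_finrank_inf_eq P.submodule Q.submodule
  rw [P.finrank_submodule, Q.finrank_submodule] at h1
  have h2 : Module.finrank 𝕜 (P.submodule ⊓ Q.submodule : Submodule 𝕜 W) ≤ 1 := by
    rw [← P.finrank_submodule]; exact Submodule.finrank_mono inf_le_left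
  have h3 : Module.finrank 𝕜 (P.submodule ⊓ Q.submodule : Submodule 𝕜 W) ≠ 1 := fun h3 =>
    h (point_eq_of_le (inf_eq_left.mp
      (Submodule.eq_of_le_of_finrank_eq inf_le_left (by rw [h3, P.finrank_submodule]))))
  omega

/-- Two distinct points of a line span it. -/
theorem sup_eq_of_mem_line {P Q : ℙ 𝕜 W} (h : P ≠ Q) {S : Submodule 𝕜 W}
    (hS : Module.finrank 𝕜 S = 2) (hP : P ∈ points S) (hQ : Q ∈ points S) :
    P.submodule ⊔ Q.submodule = S := by
  have : FiniteDimensional 𝕜 S := Module.finite_of_finrank_pos (by omega)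
  exact Submodule.eq_of_le_of_finrank_eq (sup_le hP hQ) (by rw [finrank_sup_of_ne h, hS])

/-- A minimal blocking set is a blocking set all of whose points have a tangent. -/
theorem isMinimalBlocking_of_tangent {𝓕 : Set (Submodule 𝕜 W)} {B : Set (ℙ 𝕜 W)}
    (hB : IsBlocking 𝓕 B) (ht : ∀ P ∈ B, ∃ S ∈ 𝓕, ∀ Q ∈ B, Q ∈ points S → Q = P) :
    IsMinimalBlocking 𝓕 B := by
  refine ⟨hB, fun B' hB' hle P hP => ?_⟩
  obtain ⟨S, hS, h⟩ := ht P hP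
  obtain ⟨Q, hQ, hQS⟩ := hB' S hS
  rwa [← h Q (hle hQ) hQS]

/-- The kernel of a functional that does not vanish on a plane cuts the plane in a line. -/
theorem finrank_ker_inf_plane {π : Submodule 𝕜 W} (hπ : Module.finrank 𝕜 π = 3)
    (f : W →ₗ[𝕜] 𝕜) {w : W} (hw : w ∈ π) (hf : f w ≠ 0) :
    Module.finrank 𝕜 (LinearMap.ker f ⊓ π : Submodule 𝕜 W) = 2 := by
  have : FiniteDimensional 𝕜 π := Module.finite_of_finrank_pos (by omega)
  have h1 := LinearMap.finrank_range_add_finrank_ker (f.domRestrict π)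
  have h2 : LinearMap.range (f.domRestrict π) = ⊤ :=
    LinearMap.range_eq_top.mpr (LinearMap.surjective fun h => hf (by
      simpa using LinearMap.congr_fun h ⟨w, hw⟩))
  rw [h2, finrank_top, Module.finrank_self, hπ, LinearMap.ker_domRestrict] at h1
  have h3 : (LinearMap.ker f ⊓ π : Submodule 𝕜 W)
      = (Submodule.comap π.subtype (LinearMap.ker f)).map π.subtype := by
    rw [Submodule.map_comap_subtype, inf_comm]
  rw [h3, Submodule.finrank_map_subtype_eq]
  omega

end Points

section Baer

variable {k 𝕜 W : Type*} [Field k] [Field 𝕜] [Algebra k 𝕜] [AddCommGroup W] [Module 𝕜 W]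

/-- The coordinate vectors over the subfield `k` whose linear combination of the frame `b` lies
in `S`. Its nonzero elements represent the points of the Baer subplane in `S`. -/
def subfieldCoordinates (k : Type*) [Field k] [Algebra k 𝕜] (b : Fin 3 → W) (S : Submodule 𝕜 W) :
    Submodule k (Fin 3 → k) where
  carrier := {a | ∑ i, algebraMap k 𝕜 (a i) • b i ∈ S}
  add_mem' {a a'} h h' := by
    simpa [add_smul, Finset.sum_add_distrib] using S.add_mem h h'
  zero_mem' := by simp
  smul_mem' c a h := by
    simpa [mul_smul, Finset.smul_sum] using S.smul_mem (algebraMap k 𝕜 c) h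

theorem sum_smul_ne_zero {b : Fin 3 → W} (hb : LinearIndependent 𝕜 b) {a : Fin 3 → k}
    (ha : a ≠ 0) : ∑ i, algebraMap k 𝕜 (a i) • b i ≠ 0 := fun h =>
  ha (funext fun i => by
    simpa using Fintype.linearIndependent_iff.mp hb _ h i)

theorem exists_mem_of_subfieldCoordinates {V : Set (ℙ 𝕜 W)} {b : Fin 3 → W}
    (hb : LinearIndependent 𝕜 b)
    (hV : V = {P | ∃ a : Fin 3 → k, a ≠ 0 ∧
      P.submodule = Submodule.span 𝕜 {∑ i, algebraMap k 𝕜 (a i) • b i}})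
    {a : Fin 3 → k} (ha : a ≠ 0) :
    ∃ P ∈ V, P.submodule = 𝕜 ∙ (∑ i, algebraMap k 𝕜 (a i) • b i) := by
  refine ⟨Projectivization.mk 𝕜 _ (sum_smul_ne_zero hb ha), ?_, Projectivization.submodule_mk ..⟩
  rw [hV]
  exact ⟨a, ha, Projectivization.submodule_mk ..⟩

theorem IsBaerSubplane.submodule_le {π : Submodule 𝕜 W} {V : Set (ℙ 𝕜 W)}
    (hV : IsBaerSubplane k π V) {P : ℙ 𝕜 W} (hP : P ∈ V) : P.submodule ≤ π := by
  obtain ⟨b, hb, rfl, rfl⟩ := hV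
  obtain ⟨a, -, h⟩ := hP
  rw [h, Submodule.span_singleton_le_iff_mem]
  exact Submodule.sum_mem _ fun i _ => Submodule.smul_mem _ _ (Submodule.subset_span ⟨i, rfl⟩)

/-- Over a quadratic extension, the kernel of a functional always contains a point of a Baer
subplane: its values on the subfield coordinates form a map from a space of dimension three to
one of dimension two. -/
theorem IsBaerSubplane.exists_mem_ker {π : Submodule 𝕜 W} {V : Set (ℙ 𝕜 W)}
    (hV : IsBaerSubplane k π V) (hk : Module.finrank k 𝕜 = 2) (f : W →ₗ[𝕜] 𝕜) :
    ∃ P ∈ V, P.submodule ≤ LinearMap.ker f := by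
  obtain ⟨b, hb, -, hV⟩ := hV
  have : FiniteDimensional k 𝕜 := Module.finite_of_finrank_pos (by omega)
  let g : (Fin 3 → k) →ₗ[k] 𝕜 := Fintype.linearCombination k (fun i => f (b i))
  have hg : LinearMap.ker g ≠ ⊥ := LinearMap.ker_ne_bot_of_finrank_lt (by simp [hk])
  obtain ⟨a, ha, ha0⟩ := (Submodule.ne_bot_iff _).mp hg
  obtain ⟨P, hP, h⟩ := exists_mem_of_subfieldCoordinates hb hV ha0
  refine ⟨P, hP, ?_⟩
  rw [h, Submodule.span_singleton_le_iff_mem, LinearMap.mem_ker]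
  simpa [g, Fintype.linearCombination_apply, Algebra.smul_def] using ha

/-- Two lines that each contain two points of a Baer subplane have a point of the subplane in
common, because two-dimensional subspaces of a three-dimensional space over the subfield meet. -/
theorem IsBaerSubplane.exists_mem_inter {π : Submodule 𝕜 W} {V : Set (ℙ 𝕜 W)}
    (hV : IsBaerSubplane k π V) {S S' : Submodule 𝕜 W} {P Q P' Q' : ℙ 𝕜 W}
    (hP : P ∈ V ∩ points S) (hQ : Q ∈ V ∩ points S) (hPQ : P ≠ Q)
    (hP' : P' ∈ V ∩ points S') (hQ' : Q' ∈ V ∩ points S') (hPQ' : P' ≠ Q') :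
    ∃ R ∈ V, R ∈ points S ∧ R ∈ points S' := by
  obtain ⟨b, hb, -, hV⟩ := hV
  have key : ∀ {S : Submodule 𝕜 W} {P Q : ℙ 𝕜 W}, P ∈ V ∩ points S → Q ∈ V ∩ points S → P ≠ Q →
      2 ≤ Module.finrank k (subfieldCoordinates k b S) := by
    intro S P Q hP hQ hPQ
    obtain ⟨hP, hPS⟩ := hP
    obtain ⟨hQ, hQS⟩ := hQ
    rw [hV] at hP hQ
    obtain ⟨a, ha, hPa⟩ := hP
    obtain ⟨c, hc, hQc⟩ := hQ
    rw [mem_points, hPa, Submodule.span_singleton_le_iff_mem] at hPS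
    rw [mem_points, hQc, Submodule.span_singleton_le_iff_mem] at hQS
    have hli : LinearIndependent k ![a, c] := by
      rw [LinearIndependent.pair_iff' ha]
      rintro d rfl
      apply hPQ
      refine (point_eq_of_le ?_).symm
      rw [hPa, hQc, Submodule.span_singleton_le_iff_mem, Submodule.mem_span_singleton]
      exact ⟨algebraMap k 𝕜 d, by simp [mul_smul, Finset.smul_sum]⟩
    rw [← finrank_span_eq_card hli |>.trans (Fintype.card_fin 2)]
    apply Submodule.finrank_mono
    rw [Submodule.span_le]
    rintro _ ⟨i, rfl⟩
    fin_cases i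
    · exact hPS
    · exact hQS
  have h1 := key hP hQ hPQ
  have h2 := key hP' hQ' hPQ'
  have h3 := Submodule.finrank_sup_add_finrank_inf_eq (subfieldCoordinates k b S)
    (subfieldCoordinates k b S')
  have h4 := Submodule.finrank_le (subfieldCoordinates k b S ⊔ subfieldCoordinates k b S')
  rw [Module.finrank_fin_fun] at h4
  obtain ⟨a, ⟨ha, ha'⟩, ha0⟩ := (Submodule.ne_bot_iff
    (subfieldCoordinates k b S ⊓ subfieldCoordinates k b S')).mp (by
      intro h; rw [h, finrank_bot] at h3; omega)
  obtain ⟨R, hR, h⟩ := exists_mem_of_subfieldCoordinates hb hV ha0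
  refine ⟨R, hR, ?_, ?_⟩ <;> rw [mem_points, h, Submodule.span_singleton_le_iff_mem]
  exacts [ha, ha']

/-- The point `q` is the only point of the Baer subplane on the line `tq`, so `t` is not in it. -/
theorem notMem_of_inter_eq_singleton {V : Set (ℙ 𝕜 W)} {t q u : ℙ 𝕜 W}
    (hVtq : V ∩ points (t.submodule ⊔ q.submodule) = {q})
    (hu : u ∈ points (t.submodule ⊔ q.submodule)) (huq : u ≠ q) : u ∉ V := fun h =>
  huq (by rw [← Set.mem_singleton_iff, ← hVtq]; exact ⟨h, hu⟩)

section ModifiedPlane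

/- The plane `π` with a Baer subplane `V` that meets the line `tq` in `q` only, and a line `L` of
`π` through `t`. -/
variable {π : Submodule 𝕜 W} {V : Set (ℙ 𝕜 W)} {t q s : ℙ 𝕜 W} {L : Submodule 𝕜 W}

/-- The set `(V ∖ L) ∪ {s}` meets every line through `t` other than `tq`. -/
theorem IsBaerSubplane.exists_mem_diff_union_mem_ker (hV : IsBaerSubplane k π V)
    (hk : Module.finrank k 𝕜 = 2) (hVtq : V ∩ points (t.submodule ⊔ q.submodule) = {q})
    (htq : t ≠ q) (hL : Module.finrank 𝕜 L = 2) (htL : t ∈ points L) (hs : s ∈ points L)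
    (f : W →ₗ[𝕜] 𝕜) (hft : t ∈ points (LinearMap.ker f)) :
    ∃ P ∈ (V \ points L) ∪ {s}, P ∈ points (LinearMap.ker f) := by
  obtain ⟨P, hP, hPf⟩ := hV.exists_mem_ker hk f
  by_cases hPL : P ∈ points L
  · have hPt : P ≠ t := by
      rintro rfl
      exact notMem_of_inter_eq_singleton hVtq (mem_points.mpr le_sup_left) htq hP
    refine ⟨s, Or.inr rfl, mem_points.mpr (le_trans hs ?_)⟩
    rw [← sup_eq_of_mem_line hPt hL hPL htL]
    exact sup_le hPf hft
  · exact ⟨P, Or.inl ⟨hP, hPL⟩, hPf⟩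

/-- If `L` is a secant of `V`, a line through `t` other than `tq` contains at most one point of
`(V ∖ L) ∪ {s}`: the point `t` outside `V` is on one secant only. -/
theorem IsBaerSubplane.eq_of_mem_diff_union_of_mem_ker (hV : IsBaerSubplane k π V)
    (hπ : Module.finrank 𝕜 π = 3) (hVtq : V ∩ points (t.submodule ⊔ q.submodule) = {q})
    (htq : t ≠ q) (hL : Module.finrank 𝕜 L = 2) (htL : t ∈ points L)
    (hLπ : L ≤ π) (hs : s ∈ V ∩ points L) (hL2 : ∃ P ∈ V ∩ points L, P ≠ s)
    (f : W →ₗ[𝕜] 𝕜) (hft : t ∈ points (LinearMap.ker f)) (hfq : q ∉ points (LinearMap.ker f))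
    {P P' : ℙ 𝕜 W} (hP : P ∈ (V \ points L) ∪ {s}) (hP' : P' ∈ (V \ points L) ∪ {s})
    (hPf : P ∈ points (LinearMap.ker f)) (hPf' : P' ∈ points (LinearMap.ker f)) : P = P' := by
  by_contra hne
  have hV' : ∀ {P}, P ∈ (V \ points L) ∪ {s} → P ∈ V := by
    rintro P (h | rfl)
    exacts [h.1, hs.1]
  have hqV : q ∈ V := (hVtq.ge rfl).1
  have hS : Module.finrank 𝕜 (LinearMap.ker f ⊓ π : Submodule 𝕜 W) = 2 := by
    obtain ⟨w, -, hw⟩ := exists_submodule_eq_span q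
    refine finrank_ker_inf_plane hπ f (w := w) ?_ ?_
    · rw [← Submodule.span_singleton_le_iff_mem, ← hw]
      exact hV.submodule_le hqV
    · rwa [mem_points, hw, Submodule.span_singleton_le_iff_mem] at hfq
  have hmem : ∀ {P}, P ∈ (V \ points L) ∪ {s} → P ∈ points (LinearMap.ker f) →
      P ∈ V ∩ points (LinearMap.ker f ⊓ π) := fun h h' =>
    ⟨hV' h, mem_points.mpr (le_inf h' (hV.submodule_le (hV' h)))⟩
  obtain ⟨Q, hQ, hQs⟩ := hL2
  obtain ⟨R, hRV, hR, hRL⟩ := hV.exists_mem_inter (hmem hP hPf) (hmem hP' hPf') hne hQ hs hQs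
  have hRt : R ≠ t := by
    rintro rfl
    exact notMem_of_inter_eq_singleton hVtq (mem_points.mpr le_sup_left) htq hRV
  have hLS : LinearMap.ker f ⊓ π = L := by
    rw [← sup_eq_of_mem_line hRt hL hRL htL]
    exact (sup_eq_of_mem_line hRt hS hR (mem_points.mpr (le_inf hft (le_trans htL hLπ)))).symm
  have hPs : ∀ {P}, P ∈ (V \ points L) ∪ {s} → P ∈ points (LinearMap.ker f) → P = s := by
    intro P h h'
    refine h.resolve_left fun h2 => h2.2 ?_
    rw [← hLS]
    exact (hmem h h').2
  exact hne ((hPs hP hPf).trans (hPs hP' hPf').symm)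

/-- Through a point `u` of the line `tq` other than `t` and `q` there is a tangent of `V` whose
point of `V` is on the secant `L` and different from `s`. Such a line misses `(V ∖ L) ∪ {s}`. -/
theorem IsBaerSubplane.exists_tangent_line (hV : IsBaerSubplane k π V)
    (hπ : Module.finrank 𝕜 π = 3) (hVtq : V ∩ points (t.submodule ⊔ q.submodule) = {q})
    (htq : t ≠ q) (hL : Module.finrank 𝕜 L = 2) (htL : t ∈ points L)
    (htqπ : t.submodule ⊔ q.submodule ≤ π) (hs : s ∈ V)
    (hL3 : 2 < (V ∩ points L).ncard) {u : ℙ 𝕜 W}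
    (hu : u ∈ points (t.submodule ⊔ q.submodule)) (hut : u ≠ t) (huq : u ≠ q) :
    ∃ P ∈ V ∩ points L, ∀ f : W →ₗ[𝕜] 𝕜, q ∉ points (LinearMap.ker f) →
      u ∈ points (LinearMap.ker f) → P ∈ points (LinearMap.ker f) →
      ∀ Q ∈ (V \ points L) ∪ {s}, Q ∉ points (LinearMap.ker f) := by
  have huV : u ∉ V := notMem_of_inter_eq_singleton hVtq hu huq
  have hne : ∀ {P}, P ∈ V → P ≠ u := fun h h' => huV (h' ▸ h)
  have hqV : q ∈ V := (hVtq.ge rfl).1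
  -- `L` is not the line `tq`, because it has more than one point in `V`
  have huL : u ∉ points L := by
    intro h
    have : L = t.submodule ⊔ q.submodule := by
      rw [← sup_eq_of_mem_line hut hL h htL]
      exact sup_eq_of_mem_line hut (finrank_sup_of_ne htq) hu (mem_points.mpr le_sup_left)
    rw [this, hVtq, Set.ncard_singleton] at hL3
    omega
  -- it suffices to find a tangent through `u`
  suffices h : ∃ P ∈ V ∩ points L, P ≠ s ∧
      ∀ Q ∈ V, Q ∈ points (P.submodule ⊔ u.submodule) → Q = P by
    obtain ⟨P, hP, hPs, h⟩ := h
    refine ⟨P, hP, fun f hfq hfu hfP Q hQ hfQ => ?_⟩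
    have hQV : Q ∈ V := by
      obtain h | rfl := hQ
      exacts [h.1, hs]
    have hS : Module.finrank 𝕜 (LinearMap.ker f ⊓ π : Submodule 𝕜 W) = 2 := by
      obtain ⟨w, -, hw⟩ := exists_submodule_eq_span q
      refine finrank_ker_inf_plane hπ f (w := w) ?_ ?_
      · rw [← Submodule.span_singleton_le_iff_mem, ← hw]
        exact hV.submodule_le hqV
      · rwa [mem_points, hw, Submodule.span_singleton_le_iff_mem] at hfq
    have hQP : Q = P := by
      apply h Q hQV
      rw [sup_eq_of_mem_line (hne hP.1) hS (mem_points.mpr (le_inf hfP (hV.submodule_le hP.1)))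
        (mem_points.mpr (le_inf hfu (le_trans hu htqπ)))]
      exact mem_points.mpr (le_inf hfQ (hV.submodule_le hQV))
    subst hQP
    exact hQ.elim (fun h => h.2 hP.2) hPs
  by_contra! hcon
  -- two points of `V ∩ L` other than `s`, each on a secant through `u`
  have hfin : (V ∩ points L).Finite := Set.finite_of_ncard_pos (by omega)
  have h2 : 1 < ((V ∩ points L) \ {s}).ncard := by
    have := Set.ncard_le_ncard_sdiff_add_ncard (V ∩ points L) {s}
    rw [Set.ncard_singleton] at this
    omega
  obtain ⟨P₁, hP₁, P₂, hP₂, hP⟩ := (Set.one_lt_ncard (hfin.subset Set.sdiff_subset)).mp h2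
  obtain ⟨Q₁, hQ₁, hQS₁, hQP₁⟩ := hcon P₁ hP₁.1 hP₁.2
  obtain ⟨Q₂, hQ₂, hQS₂, hQP₂⟩ := hcon P₂ hP₂.1 hP₂.2
  obtain ⟨R, hRV, hR₁, hR₂⟩ := hV.exists_mem_inter ⟨hQ₁, hQS₁⟩
    ⟨hP₁.1.1, mem_points.mpr le_sup_left⟩ hQP₁ ⟨hQ₂, hQS₂⟩
    ⟨hP₂.1.1, mem_points.mpr le_sup_left⟩ hQP₂
  -- the two secants would coincide with the line `Ru` and hence with `L`
  have e₁ := sup_eq_of_mem_line (hne hRV) (finrank_sup_of_ne (hne hP₁.1.1)) hR₁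
    (mem_points.mpr le_sup_right)
  have e₂ := sup_eq_of_mem_line (hne hRV) (finrank_sup_of_ne (hne hP₂.1.1)) hR₂
    (mem_points.mpr le_sup_right)
  have e₃ := sup_eq_of_mem_line hP (finrank_sup_of_ne (hne hRV))
    (by rw [e₁]; exact mem_points.mpr le_sup_left) (by rw [e₂]; exact mem_points.mpr le_sup_left)
  apply huL
  rw [← sup_eq_of_mem_line hP hL hP₁.1.2 hP₂.1.2, e₃]
  exact mem_points.mpr le_sup_right

end ModifiedPlane

end Baer

/-! ### Three lines without a common point in a projective plane of field elements -/

section Triangle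

variable {F K : Type*} [Field F] [Field K] [Algebra F K]

theorem exists_mem_notMem_of_finrank_eq_two {A B : Submodule F K}
    (hA : Module.finrank F A = 2) (hB : Module.finrank F B = 2) (h : A ≠ B) :
    ∃ c ∈ A, c ∉ B := by
  have : FiniteDimensional F B := Module.finite_of_finrank_pos (by omega)
  by_contra! hle
  exact h (Submodule.eq_of_le_of_finrank_eq hle (by omega))

theorem exists_mem_inf_ne_zero (hK : Module.finrank F K = 3) {A B : Submodule F K}
    (hA : Module.finrank F A = 2) (hB : Module.finrank F B = 2) :
    ∃ c, c ∈ A ∧ c ∈ B ∧ c ≠ 0 := by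
  have : FiniteDimensional F K := Module.finite_of_finrank_pos (by omega)
  have h1 := Submodule.finrank_sup_add_finrank_inf_eq A B
  have h2 := Submodule.finrank_le (A ⊔ B)
  obtain ⟨c, ⟨hc, hc'⟩, h0⟩ := (Submodule.ne_bot_iff (A ⊓ B)).mp (by
    intro h; rw [h, finrank_bot] at h1; omega)
  exact ⟨c, hc, hc', h0⟩

/-- A nonzero vector `l` of `A` lies on a line `l + F y` that meets the planes `A`, `B`, `C` with
trivial intersection only in `l`, where `y` is in one of the planes. -/
theorem exists_direction_of_mem (hK : Module.finrank F K = 3) {A B C : Submodule F K}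
    (hA : Module.finrank F A = 2) (hB : Module.finrank F B = 2) (hC : Module.finrank F C = 2)
    (h0 : ∀ c, c ∈ A → c ∈ B → c ∈ C → c = 0) {l : K} (hl : l ∈ A) (hl0 : l ≠ 0) :
    ∃ y, y ≠ 0 ∧ (y ∈ B ∨ y ∈ C) ∧ (∀ f : F, l + f • y ∈ A → f = 0) ∧
      (∀ f : F, l + f • y ∈ B → f = 0) ∧ (∀ f : F, l + f • y ∈ C → f = 0) := by
  have mem : ∀ {D : Submodule F K} {y : K}, l ∈ D → y ∉ D → ∀ f : F, l + f • y ∈ D → f = 0 := by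
    intro D y hlD hy f hf
    by_contra hf0
    exact hy ((D.smul_mem_iff hf0).mp ((D.add_mem_iff_right hlD).mp hf))
  have notMem : ∀ {D : Submodule F K} {y : K}, l ∉ D → y ∈ D → ∀ f : F, l + f • y ∈ D → f = 0 :=
    fun hlD hy f hf => absurd ((Submodule.add_mem_iff_left _ (Submodule.smul_mem _ f hy)).mp hf) hlD
  -- if `l` is in two of the planes, `y` is a vector of the third outside these two
  have two : ∀ {B C : Submodule F K}, Module.finrank F B = 2 → Module.finrank F C = 2 →
      (∀ c, c ∈ A → c ∈ B → c ∈ C → c = 0) → l ∈ B →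
      ∃ y, y ≠ 0 ∧ y ∈ C ∧ y ∉ A ∧ y ∉ B ∧ l ∉ C := by
    intro B C hB hC h0 hlB
    have hlC : l ∉ C := fun h => hl0 (h0 l hl hlB h)
    obtain ⟨a, haC, haA⟩ := exists_mem_notMem_of_finrank_eq_two hC hA (by rintro rfl; exact hlC hl)
    obtain ⟨b, hbC, hbB⟩ := exists_mem_notMem_of_finrank_eq_two hC hB
      (by rintro rfl; exact hlC hlB)
    by_cases haB : a ∈ B
    · by_cases hbA : b ∈ A
      · refine ⟨a + b, ?_, C.add_mem haC hbC, fun h => haA ((A.add_mem_iff_left hbA).mp h),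
          fun h => hbB ((B.add_mem_iff_right haB).mp h), hlC⟩
        intro h
        exact haA ((A.add_mem_iff_left hbA).mp (h ▸ A.zero_mem))
      · exact ⟨b, fun h => hbB (h ▸ B.zero_mem), hbC, hbA, hbB, hlC⟩
    · exact ⟨a, fun h => haA (h ▸ A.zero_mem), haC, haA, haB, hlC⟩
  by_cases hlB : l ∈ B
  · obtain ⟨y, hy0, hyC, hyA, hyB, hlC⟩ := two hB hC h0 hlB
    exact ⟨y, hy0, Or.inr hyC, mem hl hyA, mem hlB hyB, notMem hlC hyC⟩
  · by_cases hlC : l ∈ C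
    · obtain ⟨y, hy0, hyB, hyA, hyC, hlB⟩ := two hC hB (fun c a b d => h0 c a d b) hlC
      exact ⟨y, hy0, Or.inl hyB, mem hl hyA, notMem hlB hyB, mem hlC hyC⟩
    · obtain ⟨y, hyB, hyC, hy0⟩ := exists_mem_inf_ne_zero hK hB hC
      exact ⟨y, hy0, Or.inl hyB, mem hl fun h => hy0 (h0 y h hyB hyC), notMem hlB hyB,
        notMem hlC hyC⟩

/-- Three planes and the inverses of the vectors of a fourth one do not cover a three-dimensional
field extension with at least four scalars. -/
theorem exists_notMem_of_card [Finite F] [Finite K] (hF : 4 ≤ Nat.card F)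
    (hK : Module.finrank F K = 3) (Λ : Fin 3 → Submodule F K)
    (hΛ : ∀ i, Module.finrank F (Λ i) = 2) (χ : K →ₗ[F] F) (hχ : χ ≠ 0) :
    ∃ y, y ≠ 0 ∧ χ y⁻¹ ≠ 0 ∧ ∀ i, y ∉ Λ i := by
  have : FiniteDimensional F K := Module.finite_of_finrank_pos (by omega)
  have hker : Module.finrank F (LinearMap.ker χ) = 2 := by
    have h1 := LinearMap.finrank_range_add_finrank_ker χ
    rw [LinearMap.range_eq_top.mpr (LinearMap.surjective hχ), finrank_top, Module.finrank_self]
      at h1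
    omega
  have hcard : ∀ S : Submodule F K, Module.finrank F S = 2 →
      ((S : Set K) \ {0}).ncard + 1 = Nat.card F ^ 2 := by
    intro S hS
    rw [Set.ncard_sdiff_singleton_add_one S.zero_mem (Set.toFinite _), ← hS,
      ← Module.natCard_eq_pow_finrank (K := F) (V := S)]
    rfl
  by_contra! hcon
  have hcov : (Set.univ : Set K) \ {0} ⊆ (((Λ 0 : Set K) \ {0} ∪ (Λ 1 : Set K) \ {0}) ∪
      (Λ 2 : Set K) \ {0}) ∪ (fun c => c⁻¹) '' ((LinearMap.ker χ : Set K) \ {0}) := by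
    rintro y ⟨-, hy⟩
    by_cases hχy : χ y⁻¹ = 0
    · exact Or.inr ⟨y⁻¹, ⟨hχy, by simpa using hy⟩, inv_inv y⟩
    · obtain ⟨i, hi⟩ := hcon y hy hχy
      fin_cases i
      exacts [Or.inl (Or.inl (Or.inl ⟨hi, hy⟩)), Or.inl (Or.inl (Or.inr ⟨hi, hy⟩)),
        Or.inl (Or.inr ⟨hi, hy⟩)]
  have h1 := Set.ncard_le_ncard hcov (Set.toFinite _)
  have h2 := Set.ncard_union_le (((Λ 0 : Set K) \ {0} ∪ (Λ 1 : Set K) \ {0}) ∪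
      (Λ 2 : Set K) \ {0}) ((fun c => c⁻¹) '' ((LinearMap.ker χ : Set K) \ {0}))
  have h3 := Set.ncard_union_le ((Λ 0 : Set K) \ {0} ∪ (Λ 1 : Set K) \ {0}) ((Λ 2 : Set K) \ {0})
  have h4 := Set.ncard_union_le ((Λ 0 : Set K) \ {0}) ((Λ 1 : Set K) \ {0})
  have h5 := Set.ncard_image_le (f := fun c : K => c⁻¹)
    (Set.toFinite ((LinearMap.ker χ : Set K) \ {0}))
  have h6 := hcard _ hker
  have h7 := hcard _ (hΛ 0)
  have h8 := hcard _ (hΛ 1)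
  have h9 := hcard _ (hΛ 2)
  have h10 := Set.ncard_sdiff_singleton_add_one (Set.mem_univ (0 : K)) (Set.toFinite _)
  rw [Set.ncard_univ, Module.natCard_eq_pow_finrank (K := F) (V := K), hK] at h10
  have h11 : 4 * Nat.card F ^ 2 ≤ Nat.card F ^ 3 := by
    rw [pow_succ (Nat.card F) 2, mul_comm]
    exact Nat.mul_le_mul_left _ hF
  omega

/-- Every vector `l` of the union of three planes with trivial intersection lies on a line
`l + F y` that meets the union only in `l`, where `y` is not the inverse of a vector of the plane
`ker χ`. -/
theorem exists_direction [Finite F] [Finite K] (hF : 4 ≤ Nat.card F)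
    (hK : Module.finrank F K = 3) (Λ : Fin 3 → Submodule F K)
    (hΛ : ∀ i, Module.finrank F (Λ i) = 2) (hΛ0 : ∀ c, (∀ i, c ∈ Λ i) → c = 0)
    (χ : K →ₗ[F] F) (hχ : χ ≠ 0) (hχΛ : ∀ i, ∀ c ∈ Λ i, c ≠ 0 → χ c⁻¹ ≠ 0) {l : K} {i : Fin 3}
    (hl : l ∈ Λ i) :
    ∃ y, y ≠ 0 ∧ χ y⁻¹ ≠ 0 ∧ ∀ j, ∀ f : F, l + f • y ∈ Λ j → f = 0 := by
  by_cases hl0 : l = 0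
  · obtain ⟨y, hy0, hy, hyΛ⟩ := exists_notMem_of_card hF hK Λ hΛ χ hχ
    refine ⟨y, hy0, hy, fun j f hf => ?_⟩
    by_contra hf0
    rw [hl0, zero_add] at hf
    exact hyΛ j (((Λ j).smul_mem_iff hf0).mp hf)
  · have hj : ∀ i j : Fin 3, j = i ∨ j = i + 1 ∨ j = i + 2 := by decide
    have hcommon : ∀ c, c ∈ Λ i → c ∈ Λ (i + 1) → c ∈ Λ (i + 2) → c = 0 := by
      intro c h h' h''
      refine hΛ0 c fun j => ?_
      obtain rfl | rfl | rfl := hj i j <;> assumption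
    obtain ⟨y, hy0, hy, h1, h2, h3⟩ := exists_direction_of_mem hK (hΛ i) (hΛ (i + 1)) (hΛ (i + 2))
      hcommon hl hl0
    refine ⟨y, hy0, hy.elim (fun h => hχΛ _ y h hy0) (fun h => hχΛ _ y h hy0), fun j f hf => ?_⟩
    obtain rfl | rfl | rfl := hj i j
    exacts [h1 f hf, h2 f hf, h3 f hf]

end Triangle

/-! ### The affine form of the blocking set -/

section Affine

variable {F K U : Type*} [Field F] [Field K] [Algebra F K] [AddCommGroup U] [Module K U]

theorem exists_functional {x₀ x₁ d : U} (hU : Module.finrank K U = 3)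
    (hli : LinearIndependent K ![x₀, x₁, d]) (a b c : K) :
    ∃ φ : U →ₗ[K] K, φ x₀ = a ∧ φ x₁ = b ∧ φ d = c := by
  let B := basisOfLinearIndependentOfCardEqFinrank hli (by simp [hU])
  have hB : ∀ i, B i = ![x₀, x₁, d] i := fun i => by simp [B]
  refine ⟨B.constr K ![a, b, c], ?_, ?_, ?_⟩
  · simpa [hB] using B.constr_basis K ![a, b, c] 0
  · simpa [hB] using B.constr_basis K ![a, b, c] 1
  · simpa [hB] using B.constr_basis K ![a, b, c] 2

variable [Module F U] [IsScalarTower F K U]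

/-- The affine point set `{v + c r₀ : v ∈ V₀, c ∈ F} ∪ {h₀ + l x₁ : l ∈ Λ₀ ∪ Λ₁ ∪ Λ₂}` of `U`. The
first part is the union of the lines of direction `r₀` through the points of `V₀`, the second is
the affine part of a cone with vertex `h₀`. -/
def affineUnion (V₀ : Set U) (r₀ h₀ x₁ : U) (Λ : Fin 3 → Submodule F K) : Set U :=
  {u | (∃ v ∈ V₀, ∃ c : F, u = v + c • r₀) ∨ ∃ i, ∃ l ∈ Λ i, u = h₀ + l • x₁}

/-- The functional `(u, a) ↦ χ (φ u) - a χ κ` on `U × F`. It vanishes at the affine point `(u, 1)`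
if and only if `φ u - κ` is in the kernel of `χ`. -/
def liftFunctional (φ : U →ₗ[K] K) (χ : K →ₗ[F] F) (κ : K) : (U × F) →ₗ[F] F :=
  (χ ∘ₗ φ.restrictScalars F).coprod (LinearMap.toSpanSingleton F F (-χ κ))

theorem liftFunctional_apply (φ : U →ₗ[K] K) (χ : K →ₗ[F] F) (κ : K) (u : U) (a : F) :
    liftFunctional φ χ κ (u, a) = χ (φ u) - a * χ κ := by
  simp [liftFunctional, sub_eq_add_neg]

variable {x₀ x₁ h₀ : U} {ρ θ : K} {χ : K →ₗ[F] F} {V₀ : Set U} {Λ : Fin 3 → Submodule F K}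

/-- Every coset of `ker φ + F x₀`, where `φ x₀ = 1`, contains a point of the affine set. If `φ`
vanishes on `x₁` it is a point of the first part, otherwise it is a point of the second. -/
theorem exists_mem_affineUnion (hK : Module.finrank F K = 3)
    (hχ : ∀ c, χ c = 0 ↔ ∃ a b : F, c = algebraMap F K a + b • ρ) (hθ : χ θ ≠ 0)
    (hΛ : ∀ i, Module.finrank F (Λ i) = 2) (hΛ0 : ∀ c, (∀ i, c ∈ Λ i) → c = 0)
    (hV : ∀ f : (U × F) →ₗ[F] F, f (x₁, 0) = 0 → f (θ • x₀, 0) ≠ 0 → ∃ v ∈ V₀, f (v, 1) = 0)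
    (φ : U →ₗ[K] K) (hφ : φ x₀ = 1) (κ : K) :
    ∃ u ∈ affineUnion V₀ (ρ • x₀) h₀ x₁ Λ, ∃ f : F, φ u = κ + algebraMap F K f := by
  by_cases hφ1 : φ x₁ = 0
  · obtain ⟨v, hv, h⟩ := hV (liftFunctional φ χ κ) (by simp [liftFunctional_apply, hφ1])
      (by simpa [liftFunctional_apply, hφ] using hθ)
    rw [liftFunctional_apply, one_mul, ← map_sub, hχ] at h
    obtain ⟨a, b, h⟩ := h
    refine ⟨v + (-b) • ρ • x₀, Or.inl ⟨v, hv, -b, rfl⟩, a, ?_⟩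
    rw [map_add, LinearMap.map_smul_of_tower, map_smul, hφ, smul_eq_mul, mul_one, neg_smul,
      eq_add_of_sub_eq h]
    ring
  · have : FiniteDimensional F K := Module.finite_of_finrank_pos (by omega)
    obtain ⟨i, hi⟩ : ∃ i, (φ x₁)⁻¹ ∉ Λ i := by
      by_contra! hcon
      exact hφ1 (inv_eq_zero.mp (hΛ0 _ hcon))
    have htop : Λ i ⊔ F ∙ (φ x₁)⁻¹ = ⊤ := by
      apply Submodule.eq_top_of_finrank_eq
      have h1 : Λ i < Λ i ⊔ F ∙ (φ x₁)⁻¹ := by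
        refine lt_of_le_of_ne le_sup_left fun h => hi ?_
        rw [h]
        exact Submodule.mem_sup_right (Submodule.mem_span_singleton_self _)
      have h2 := Submodule.finrank_lt_finrank_of_lt h1
      have h3 := Submodule.finrank_le (Λ i ⊔ F ∙ (φ x₁)⁻¹)
      have := hΛ i
      omega
    obtain ⟨l, hl, z, hz, h⟩ := Submodule.mem_sup.mp
      (htop ▸ Submodule.mem_top : (κ - φ h₀) * (φ x₁)⁻¹ ∈ Λ i ⊔ F ∙ (φ x₁)⁻¹)
    obtain ⟨f, rfl⟩ := Submodule.mem_span_singleton.mp hz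
    refine ⟨h₀ + l • x₁, Or.inr ⟨i, l, hl, rfl⟩, -f, ?_⟩
    have h' : l = (κ - φ h₀ - algebraMap F K f) * (φ x₁)⁻¹ := by
      rw [Algebra.smul_def] at h
      linear_combination h
    rw [map_add, map_smul, h', smul_eq_mul, inv_mul_cancel_right₀ hφ1, map_neg]
    ring

/-- Through every point of the affine set there is a coset of some `ker φ + F x₀`, where
`φ x₀ = 1`, that contains no other point of the set. For a point of the first part `φ` vanishes on
`x₁`, and the points of the second part are avoided because they all have the same image under
`φ`. For a point of the second part, `φ x₁` is chosen such that the coset misses the other points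
of that part, and the value of `φ` at the point of a suitable tangent of the Baer subplane is
chosen such that it misses the first part. -/
theorem exists_tangent_affineUnion [Finite F] [Finite K] (hF : 4 ≤ Nat.card F)
    (hU : Module.finrank K U = 3) (hK : Module.finrank F K = 3)
    (hχ : ∀ c, χ c = 0 ↔ ∃ a b : F, c = algebraMap F K a + b • ρ) (hθ : χ θ ≠ 0)
    (hρ : ∀ a : F, ρ ≠ algebraMap F K a)
    (hΛ : ∀ i, Module.finrank F (Λ i) = 2) (hΛ0 : ∀ c, (∀ i, c ∈ Λ i) → c = 0)
    (hχΛ : ∀ i, ∀ c ∈ Λ i, c ≠ 0 → χ c⁻¹ ≠ 0)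
    (hli : ∀ v ∈ V₀, LinearIndependent K ![x₀, x₁, h₀ - v])
    (huniq : ∀ f : (U × F) →ₗ[F] F, f (x₁, 0) = 0 → f (θ • x₀, 0) ≠ 0 →
      ∀ v ∈ V₀, ∀ v' ∈ V₀, f (v, 1) = 0 → f (v', 1) = 0 → v = v')
    (htan : ∀ e : F, e ≠ 0 → ∃ v, LinearIndependent K ![x₀, x₁, h₀ - v] ∧
      ∀ f : (U × F) →ₗ[F] F, f (θ • x₀, 0) ≠ 0 → f (x₁, 0) = e * f (θ • x₀, 0) → f (v, 1) = 0 →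
        ∀ v' ∈ V₀, f (v', 1) ≠ 0)
    {u : U} (hu : u ∈ affineUnion V₀ (ρ • x₀) h₀ x₁ Λ) :
    ∃ φ : U →ₗ[K] K, φ x₀ = 1 ∧ ∀ u' ∈ affineUnion V₀ (ρ • x₀) h₀ x₁ Λ, ∀ f : F,
      φ u' = φ u + algebraMap F K f → u' = u := by
  obtain ⟨v, hv, c, rfl⟩ | ⟨i, l, hl, rfl⟩ := hu
  · obtain ⟨φ, h0, h1, h2⟩ := exists_functional hU (hli v hv) 1 0 (ρ + c • ρ)
    refine ⟨φ, h0, ?_⟩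
    rintro u' (⟨v', hv', c', rfl⟩ | ⟨i, l, -, rfl⟩) f hf
    · simp only [map_add, LinearMap.map_smul_of_tower, map_smul, h0, smul_eq_mul, mul_one] at hf
      have hvv : v = v' := by
        refine huniq (liftFunctional φ χ (φ v)) (by simp [liftFunctional_apply, h1])
          (by simpa [liftFunctional_apply, h0] using hθ) v hv v' hv'
          (by simp [liftFunctional_apply]) ?_
        rw [liftFunctional_apply, one_mul, ← map_sub, hχ]
        refine ⟨f, c - c', ?_⟩
        rw [sub_smul]
        linear_combination hf
      subst hvv
      have hc : c' = c := by
        by_contra hne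
        have hne' : c' - c ≠ 0 := sub_ne_zero.mpr hne
        refine hρ ((c' - c)⁻¹ * f) ?_
        have h3 : (c' - c) • ρ = algebraMap F K f := by
          rw [sub_smul]
          linear_combination hf
        rw [map_mul, ← h3, ← Algebra.smul_def, inv_smul_smul₀ hne']
      rw [hc]
    · exfalso
      simp only [map_add, map_sub, LinearMap.map_smul_of_tower, map_smul, h0, h1, smul_eq_mul,
        mul_one, mul_zero, add_zero] at hf h2
      exact hρ f (by linear_combination hf - h2)
  · obtain ⟨y, hy0, hy, hyΛ⟩ := exists_direction hF hK Λ hΛ hΛ0 χ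
      (by rintro rfl; exact hθ rfl) hχΛ hl
    obtain ⟨v, hvli, hvtan⟩ := htan (χ y⁻¹ / χ θ) (div_ne_zero hy hθ)
    obtain ⟨φ, h0, h1, h2⟩ := exists_functional hU hvli 1 y⁻¹ (-(l * y⁻¹))
    have hfv : φ v = φ (h₀ + l • x₁) := by
      simp only [map_sub, map_add, map_smul, h1, smul_eq_mul] at h2 ⊢
      linear_combination -h2
    refine ⟨φ, h0, ?_⟩
    rintro u' (⟨v', hv', c', rfl⟩ | ⟨j, l', hl', rfl⟩) f hf
    · exfalso
      refine hvtan (liftFunctional φ χ (φ v)) (by simpa [liftFunctional_apply, h0] using hθ) ?_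
        (by simp [liftFunctional_apply]) v' hv' ?_
      · simp [liftFunctional_apply, h0, h1, hθ]
      · rw [liftFunctional_apply, one_mul, ← map_sub, hχ]
        refine ⟨f, -c', ?_⟩
        rw [← hfv, map_add, LinearMap.map_smul_of_tower, map_smul, h0, smul_eq_mul, mul_one] at hf
        rw [neg_smul]
        linear_combination hf
    · have hll : l' = l + f • y := by
        simp only [map_add, map_smul, h1, smul_eq_mul] at hf
        have : (l' - l) * y⁻¹ = algebraMap F K f := by linear_combination hf
        rw [Algebra.smul_def, ← this, inv_mul_cancel_right₀ hy0]
        ring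
      have hf0 := hyΛ j f (hll ▸ hl')
      rw [hll, hf0, zero_smul, add_zero]

end Affine

/-! ### Affine points of the two projective spaces -/

section AffinePoints

variable {F K U : Type*} [Field F] [Field K] [Algebra F K] [AddCommGroup U] [Module K U]
  [Module F U]

variable (F) in
/-- The point of the projective space of `U × F` outside the hyperplane `U × 0` that is
represented by `(u, 1)`. It is also used with `K` in place of `F`. -/
def affinePoint (u : U) : ℙ F (U × F) := Projectivization.mk F (u, 1) (by simp)

theorem affinePoint_submodule (u : U) : (affinePoint F u).submodule = F ∙ (u, (1 : F)) :=
  Projectivization.submodule_mk ..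

theorem affinePoint_mem_points {u : U} {S : Submodule F (U × F)} :
    affinePoint F u ∈ points S ↔ (u, (1 : F)) ∈ S := mk_mem_points _

theorem affinePoint_injective : Function.Injective (affinePoint F : U → ℙ F (U × F)) := by
  intro u v h
  obtain ⟨a, ha⟩ := (Projectivization.mk_eq_mk_iff' F _ _ _ _).mp h
  have h1 : a = 1 := by simpa using congrArg Prod.snd ha
  simpa [h1] using (congrArg Prod.fst ha).symm

theorem mem_infinity {x : U × F} : x ∈ infinity F U ↔ x.2 = 0 := by
  simp only [infinity, LinearMap.mem_range, LinearMap.inl_apply]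
  constructor
  · rintro ⟨y, rfl⟩; rfl
  · intro h; exact ⟨x.1, by rw [← h]⟩

theorem mem_atInfinity [IsScalarTower F K U] {Y : Submodule K U} {x : U × F} :
    x ∈ atInfinity F Y ↔ x.1 ∈ Y ∧ x.2 = 0 := by
  simp only [atInfinity, Submodule.mem_map, Submodule.restrictScalars_mem, LinearMap.inl_apply]
  constructor
  · rintro ⟨y, hy, rfl⟩; exact ⟨hy, rfl⟩
  · rintro ⟨hy, h⟩; exact ⟨x.1, hy, by rw [← h]⟩

theorem affinePoint_notMem_infinity (u : U) : affinePoint F u ∉ points (infinity F U) := by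
  rw [affinePoint_mem_points, mem_infinity]
  exact one_ne_zero

theorem exists_eq_affinePoint {P : ℙ F (U × F)} (h : P ∉ points (infinity F U)) :
    ∃ u, P = affinePoint F u := by
  obtain ⟨⟨u, a⟩, h0, hP⟩ := exists_submodule_eq_span P
  have ha : a ≠ 0 := by
    rintro rfl
    apply h
    rw [mem_points, hP, Submodule.span_singleton_le_iff_mem, mem_infinity]
  refine ⟨a⁻¹ • u, point_eq_of_le ?_⟩
  rw [hP, affinePoint_submodule, Submodule.span_singleton_le_iff_mem,
    Submodule.mem_span_singleton]
  exact ⟨a, by simp [smul_smul, ha]⟩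

/-- The points of the line that joins a point at infinity and an affine point. -/
theorem eq_of_le_sup_affinePoint {P : ℙ F (U × F)} {w u : U}
    (h : P.submodule ≤ (F ∙ (w, (0 : F))) ⊔ (affinePoint F u).submodule) :
    P.submodule ≤ (F ∙ (w, (0 : F))) ∨ ∃ c : F, P = affinePoint F (u + c • w) := by
  obtain ⟨x, h0, hP⟩ := exists_submodule_eq_span P
  rw [hP, Submodule.span_singleton_le_iff_mem, affinePoint_submodule] at h
  obtain ⟨y, hy, z, hz, rfl⟩ := Submodule.mem_sup.mp h
  obtain ⟨c, rfl⟩ := Submodule.mem_span_singleton.mp hy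
  obtain ⟨d, rfl⟩ := Submodule.mem_span_singleton.mp hz
  by_cases hd : d = 0
  · left
    rw [hP, Submodule.span_singleton_le_iff_mem]
    simpa [hd] using hy
  · right
    refine ⟨d⁻¹ * c, point_eq_of_le ?_⟩
    rw [hP, affinePoint_submodule, Submodule.span_singleton_le_iff_mem,
      Submodule.mem_span_singleton]
    refine ⟨d, ?_⟩
    rw [Prod.ext_iff]
    simp [smul_smul, hd, add_comm]

theorem affinePoint_add_le (w u : U) (c : F) : (affinePoint F (u + c • w)).submodule ≤
    (F ∙ (w, (0 : F))) ⊔ (affinePoint F u).submodule := by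
  rw [affinePoint_submodule, affinePoint_submodule, Submodule.span_singleton_le_iff_mem]
  refine Submodule.mem_sup.mpr ⟨c • (w, 0), Submodule.smul_mem _ _
    (Submodule.mem_span_singleton_self _), (u, 1), Submodule.mem_span_singleton_self _, ?_⟩
  simp [add_comm]

theorem toPG3_affinePoint [IsScalarTower F K U] (u : U) :
    toPG3 F K U (affinePoint F u) = affinePoint K u := by
  unfold toPG3 affinePoint
  rw [Projectivization.map_mk]
  congr 1
  simp [inclusion]

end AffinePoints

/-! ### The two families of hyperplanes in terms of functionals -/

section Functionals

variable {F K U : Type*} [Field F] [Field K] [Algebra F K] [AddCommGroup U] [Module K U]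
  [Module F U] [IsScalarTower F K U]

theorem finrank_eq_nine (hU : Module.finrank K U = 3) (hK : Module.finrank F K = 3) :
    Module.finrank F U = 9 := by
  rw [← Module.finrank_mul_finrank F K U, hU, hK]

theorem atInfinity_le_infinity (Y : Submodule K U) : atInfinity F Y ≤ infinity F U := by
  intro x hx
  exact mem_infinity.mpr (mem_atInfinity.mp hx).2

theorem finrank_atInfinity (Y : Submodule K U) :
    Module.finrank F (atInfinity F Y) = Module.finrank F K * Module.finrank K Y := by
  rw [Module.finrank_mul_finrank F K Y]
  exact (Submodule.equivMapOfInjective _ LinearMap.inl_injective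
    (Y.restrictScalars F)).finrank_eq.symm

/-- The affine part of an element of `ℌ` contains a coset of `ker φ + F x₀` for some functional
`φ` with `φ x₀ = 1`. -/
theorem exists_functional_of_mem_familyH (hU : Module.finrank K U = 3)
    (hK : Module.finrank F K = 3) {x₀ : U} {p : ℙ F (U × F)}
    (hp : p.submodule = F ∙ (x₀, (0 : F))) {S : Submodule F (U × F)}
    (hS : S ∈ familyH F K U (atInfinity F (K ∙ x₀)) p) :
    ∃ (φ : U →ₗ[K] K) (κ : K), φ x₀ = 1 ∧
      ∀ (u : U) (f : F), φ u = κ + algebraMap F K f → affinePoint F u ∈ points S := by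
  have : FiniteDimensional K U := Module.finite_of_finrank_pos (by omega)
  have : FiniteDimensional F K := Module.finite_of_finrank_pos (by omega)
  have : FiniteDimensional F U := Module.Finite.trans K U
  obtain ⟨T, hT, hXT, rfl⟩ := hS
  obtain rfl | ⟨hT7, Y, hY, hTY⟩ := hT
  · exact absurd (atInfinity_le_infinity _) hXT
  have hx₀ : x₀ ∉ Y := by
    intro h
    apply hXT
    refine le_trans ?_ (inf_le_left (b := infinity F U))
    rw [hTY]
    intro x hx
    rw [mem_atInfinity] at hx ⊢
    exact ⟨(Submodule.span_singleton_le_iff_mem _ _).mpr h hx.1, hx.2⟩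
  -- `T` has an affine point, because its part at infinity has smaller dimension
  obtain ⟨w, hw⟩ : ∃ w : U, (w, (1 : F)) ∈ T := by
    have hYF : Module.finrank F (atInfinity F Y) = 6 := by
      rw [finrank_atInfinity, hK, hY]
    have hnle : ¬ T ≤ infinity F U := by
      intro h
      rw [inf_eq_left.mpr h] at hTY
      rw [hTY] at hT7
      omega
    obtain ⟨⟨w, a⟩, hwT, hw⟩ := SetLike.not_le_iff_exists.mp hnle
    rw [mem_infinity] at hw
    refine ⟨a⁻¹ • w, ?_⟩
    simpa [hw] using T.smul_mem a⁻¹ hwT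
  obtain ⟨φ, hφ0, hφ⟩ := Submodule.exists_le_ker_of_lt_top Y (lt_top_iff_ne_top.mpr (by
    rintro rfl; rw [finrank_top] at hY; omega))
  have hker : Y = LinearMap.ker φ := by
    apply Submodule.eq_of_le_of_finrank_eq hφ
    have h1 := LinearMap.finrank_range_add_finrank_ker φ
    rw [LinearMap.range_eq_top.mpr (LinearMap.surjective hφ0), finrank_top,
      Module.finrank_self] at h1
    omega
  have hφx : φ x₀ ≠ 0 := fun h => hx₀ (hker ▸ h)
  refine ⟨(φ x₀)⁻¹ • φ, (φ x₀)⁻¹ * φ w, by simp [hφx], fun u f hu => ?_⟩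
  rw [affinePoint_mem_points, hp]
  have hmem : u - w - f • x₀ ∈ Y := by
    rw [hker, LinearMap.mem_ker, map_sub, map_sub, LinearMap.map_smul_of_tower, Algebra.smul_def]
    rw [LinearMap.smul_apply, smul_eq_mul] at hu
    have h2 := congrArg (φ x₀ * ·) hu
    simp only [mul_add, mul_inv_cancel_left₀ hφx] at h2
    linear_combination h2
  refine Submodule.mem_sup.mpr ⟨(w, 1) + (u - w - f • x₀, 0), T.add_mem hw ?_, f • (x₀, 0),
    Submodule.smul_mem _ _ (Submodule.mem_span_singleton_self _), by
      simp only [Prod.smul_mk, smul_zero, Prod.mk_add_mk, add_zero]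
      congr 1
      abel⟩
  refine inf_le_left (b := infinity F U) ?_
  rw [hTY]
  exact mem_atInfinity.mpr ⟨hmem, rfl⟩

/-- Every coset of `ker φ + F x₀`, where `φ x₀ = 1`, contains the affine part of an element of
`ℌ`. -/
theorem exists_mem_familyH (hU : Module.finrank K U = 3)
    (hK : Module.finrank F K = 3) {x₀ : U} {p : ℙ F (U × F)}
    (hp : p.submodule = F ∙ (x₀, (0 : F))) (φ : U →ₗ[K] K) (hφ : φ x₀ = 1) (κ : K) :
    ∃ S ∈ familyH F K U (atInfinity F (K ∙ x₀)) p,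
      ∀ u, affinePoint F u ∈ points S → ∃ f : F, φ u = κ + algebraMap F K f := by
  have : FiniteDimensional K U := Module.finite_of_finrank_pos (by omega)
  have : FiniteDimensional F K := Module.finite_of_finrank_pos (by omega)
  have : FiniteDimensional F U := Module.Finite.trans K U
  let g : (U × F) →ₗ[F] K :=
    (φ.restrictScalars F).coprod (LinearMap.toSpanSingleton F K (-κ))
  have hg : ∀ u a, g (u, a) = φ u - a • κ := fun u a => by simp [g, sub_eq_add_neg]
  have hsurj : Function.Surjective φ := LinearMap.surjective (by rintro rfl; simp at hφ)
  have hgsurj : LinearMap.range g = ⊤ := LinearMap.range_eq_top.mpr fun c => by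
    obtain ⟨u, hu⟩ := hsurj c
    exact ⟨(u, 0), by simp [hg, hu]⟩
  refine ⟨LinearMap.ker g ⊔ p.submodule, ⟨LinearMap.ker g, Or.inr ⟨?_, LinearMap.ker φ, ?_, ?_⟩,
    ?_, rfl⟩, ?_⟩
  · have h1 := LinearMap.finrank_range_add_finrank_ker g
    rw [hgsurj, finrank_top, hK, Module.finrank_prod, Module.finrank_self,
      finrank_eq_nine hU hK] at h1
    omega
  · have h1 := LinearMap.finrank_range_add_finrank_ker φ
    rw [LinearMap.range_eq_top.mpr hsurj, finrank_top, Module.finrank_self] at h1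
    omega
  · ext ⟨u, a⟩
    simp only [Submodule.mem_inf, LinearMap.mem_ker, hg, mem_infinity, mem_atInfinity]
    constructor
    · rintro ⟨h, rfl⟩
      simpa using h
    · rintro ⟨h, rfl⟩
      simpa using h
  · intro h
    have h1 : (x₀, (0 : F)) ∈ LinearMap.ker g :=
      h (mem_atInfinity.mpr ⟨Submodule.mem_span_singleton_self _, rfl⟩)
    simp [hg, hφ] at h1
  · intro u hu
    rw [affinePoint_mem_points, hp] at hu
    obtain ⟨⟨w, a⟩, hw, z, hz, h⟩ := Submodule.mem_sup.mp hu
    obtain ⟨f, rfl⟩ := Submodule.mem_span_singleton.mp hz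
    rw [LinearMap.mem_ker, hg] at hw
    rw [Prod.ext_iff] at h
    obtain ⟨h1, h2⟩ := h
    simp only [Prod.smul_mk, smul_zero, Prod.mk_add_mk, add_zero] at h1 h2
    refine ⟨f, ?_⟩
    rw [← h1, map_add, LinearMap.map_smul_of_tower, hφ, sub_eq_zero.mp hw, h2, one_smul,
      Algebra.smul_def, mul_one]

/-- If an affine set meets every coset of `ker φ + F x₀`, and some such coset meets it only in a
prescribed point, it is a minimal blocking set for `ℌ`. -/
theorem isMinimalBlocking_familyH (hU : Module.finrank K U = 3)
    (hK : Module.finrank F K = 3) {x₀ : U} {p : ℙ F (U × F)}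
    (hp : p.submodule = F ∙ (x₀, (0 : F))) {A : Set U}
    (hA : ∀ φ : U →ₗ[K] K, φ x₀ = 1 → ∀ κ : K, ∃ u ∈ A, ∃ f : F, φ u = κ + algebraMap F K f)
    (htan : ∀ u ∈ A, ∃ φ : U →ₗ[K] K, φ x₀ = 1 ∧ ∀ u' ∈ A, ∀ f : F,
      φ u' = φ u + algebraMap F K f → u' = u) :
    IsMinimalBlocking (familyH F K U (atInfinity F (K ∙ x₀)) p) (affinePoint F '' A) := by
  apply isMinimalBlocking_of_tangent
  · intro S hS
    obtain ⟨φ, κ, hφ, h⟩ := exists_functional_of_mem_familyH hU hK hp hS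
    obtain ⟨u, hu, f, hf⟩ := hA φ hφ κ
    exact ⟨affinePoint F u, ⟨u, hu, rfl⟩, h u f hf⟩
  · rintro _ ⟨u, hu, rfl⟩
    obtain ⟨φ, hφ, h⟩ := htan u hu
    obtain ⟨S, hS, hSu⟩ := exists_mem_familyH hU hK hp φ hφ (φ u)
    refine ⟨S, hS, ?_⟩
    rintro _ ⟨u', hu', rfl⟩ hmem
    obtain ⟨f, hf⟩ := hSu u' hmem
    rw [h u' hu' f hf]

/-- The point set of the projective space of `U × K` formed by the point `K x₀` at infinity and the
affine points of the lines of direction `F x₀` through the points of `A`. -/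
def coneImage (F : Type*) {K U : Type*} [Field F] [Field K] [AddCommGroup U]
    [Module K U] [Module F U] (x₀ : U) (A : Set U) : Set (ℙ K (U × K)) :=
  {P | P.submodule = K ∙ (x₀, (0 : K))} ∪ {P | ∃ u ∈ A, ∃ f : F, P = affinePoint K (u + f • x₀)}

/-- The conditions of `isMinimalBlocking_familyH` also make the set `coneImage` a minimal blocking
set with respect to planes: the tangent plane at an affine point has the same functional, and the
plane at infinity is the tangent plane at `K x₀`. -/
theorem isMinimalBlocking_coneImage (hU : Module.finrank K U = 3) {x₀ : U} (hx₀ : x₀ ≠ 0)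
    {A : Set U}
    (hA : ∀ φ : U →ₗ[K] K, φ x₀ = 1 → ∀ κ : K, ∃ u ∈ A, ∃ f : F, φ u = κ + algebraMap F K f)
    (htan : ∀ u ∈ A, ∃ φ : U →ₗ[K] K, φ x₀ = 1 ∧ ∀ u' ∈ A, ∀ f : F,
      φ u' = φ u + algebraMap F K f → u' = u) :
    IsMinimalBlocking (planes K (U × K)) (coneImage F x₀ A : Set (ℙ K (U × K))) := by
  have : FiniteDimensional K U := Module.finite_of_finrank_pos (by omega)
  have h4 : Module.finrank K (U × K) = 4 := by
    rw [Module.finrank_prod, hU, Module.finrank_self]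
  have hker : ∀ g : (U × K) →ₗ[K] K, g ≠ 0 → Module.finrank K (LinearMap.ker g) = 3 := by
    intro g hg
    have h1 := LinearMap.finrank_range_add_finrank_ker g
    rw [LinearMap.range_eq_top.mpr (LinearMap.surjective hg), finrank_top,
      Module.finrank_self] at h1
    omega
  apply isMinimalBlocking_of_tangent
  · intro M hM
    have hM3 : Module.finrank K M = 3 := hM
    obtain ⟨g, hg0, hg⟩ := Submodule.exists_le_ker_of_lt_top M (lt_top_iff_ne_top.mpr (by
      rintro rfl; rw [finrank_top] at hM3; omega))
    obtain rfl : M = LinearMap.ker g :=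
      Submodule.eq_of_le_of_finrank_eq hg (by rw [hM3, hker g hg0])
    by_cases h0 : g (x₀, 0) = 0
    · refine ⟨Projectivization.mk K (x₀, 0) (by simpa using hx₀),
        Or.inl (Projectivization.submodule_mk ..), (mk_mem_points _).mpr h0⟩
    · obtain ⟨u, hu, f, hf⟩ := hA ((g (x₀, 0))⁻¹ • g ∘ₗ LinearMap.inl K U K) (by simp [h0])
        (-((g (x₀, 0))⁻¹ * g (0, 1)))
      refine ⟨affinePoint K (u + (-f) • x₀), Or.inr ⟨u, hu, -f, rfl⟩, ?_⟩
      rw [affinePoint_mem_points, LinearMap.mem_ker]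
      have h1 : (u + (-f) • x₀, (1 : K)) =
          (u, 0) - algebraMap F K f • (x₀, (0 : K)) + (0, 1) := by
        simp [sub_eq_add_neg]
      rw [h1, map_add, map_sub, map_smul, smul_eq_mul]
      simp only [LinearMap.smul_apply, LinearMap.comp_apply, LinearMap.inl_apply,
        smul_eq_mul] at hf
      have h2 := congrArg (g (x₀, 0) * ·) hf
      simp only [mul_add, mul_neg, mul_inv_cancel_left₀ h0] at h2
      linear_combination h2
  · rintro P (hP | ⟨u, hu, f, rfl⟩)
    · refine ⟨infinity K U, ?_, ?_⟩
      · change Module.finrank K (infinity K U) = 3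
        rw [infinity, LinearMap.finrank_range_of_inj LinearMap.inl_injective, hU]
      · rintro Q (hQ | ⟨u, hu, f, rfl⟩) hQM
        · exact point_ext (hQ.trans hP.symm)
        · exact absurd hQM (affinePoint_notMem_infinity _)
    · obtain ⟨φ, hφ, h⟩ := htan u hu
      let g : (U × K) →ₗ[K] K :=
        φ.coprod (LinearMap.toSpanSingleton K K (-φ (u + f • x₀)))
      have hg : ∀ w a, g (w, a) = φ w - a * φ (u + f • x₀) := fun w a => by
        simp only [g, LinearMap.coprod_apply, LinearMap.toSpanSingleton_apply, smul_eq_mul]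
        ring
      refine ⟨LinearMap.ker g, hker g fun hg0 => ?_, ?_⟩
      · have h1 := hg x₀ 0
        rw [hg0, hφ] at h1
        simp at h1
      · rintro Q (hQ | ⟨u', hu', f', rfl⟩) hQM
        · exfalso
          rw [mem_points, hQ, Submodule.span_singleton_le_iff_mem, LinearMap.mem_ker, hg, hφ] at hQM
          simp at hQM
        · rw [affinePoint_mem_points, LinearMap.mem_ker, hg, map_add, map_add,
            LinearMap.map_smul_of_tower, LinearMap.map_smul_of_tower, hφ, Algebra.smul_def,
            Algebra.smul_def] at hQM
          obtain rfl := h u' hu' (f - f') (by rw [map_sub]; linear_combination hQM)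
          have hff : algebraMap F K f' = algebraMap F K f := by linear_combination hQM
          rw [(algebraMap F K).injective hff]

/-- If the points of `A` outside the spread element `K x₀` are the affine points of a nonempty set,
the cone with vertex `F x₀` over `A` has the image `coneImage`. -/
theorem toPG3_image_cone {x₀ : U} {p : ℙ F (U × F)}
    (hp : p.submodule = F ∙ (x₀, (0 : F))) {A : Set (ℙ F (U × F))} {A₀ : Set U}
    (hA : A \ points (atInfinity F (K ∙ x₀)) = affinePoint F '' A₀) (hne : A₀.Nonempty) :
    toPG3 F K U '' cone p A = coneImage F x₀ A₀ := by
  have hpX : p.submodule ≤ atInfinity F (K ∙ x₀) := by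
    rw [hp, Submodule.span_singleton_le_iff_mem, mem_atInfinity]
    exact ⟨Submodule.mem_span_singleton_self _, rfl⟩
  have hX : ∀ Q : ℙ F (U × F), Q.submodule ≤ atInfinity F (K ∙ x₀) →
      (toPG3 F K U Q).submodule = K ∙ (x₀, (0 : K)) := by
    intro Q
    induction Q using Projectivization.ind with
    | h y hy =>
      intro hQ
      rw [Projectivization.submodule_mk, Submodule.span_singleton_le_iff_mem, mem_atInfinity] at hQ
      obtain ⟨u, a⟩ := y
      obtain ⟨h1, h2⟩ := hQ
      obtain rfl : a = 0 := h2
      obtain ⟨c, rfl⟩ := Submodule.mem_span_singleton.mp h1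
      have hc : c ≠ 0 := by
        rintro rfl
        simp at hy
      rw [toPG3, Projectivization.map_mk, Projectivization.submodule_mk]
      have : inclusion F K U (c • x₀, 0) = c • (x₀, (0 : K)) := by simp [inclusion]
      rw [this, Submodule.span_singleton_smul_eq (IsUnit.mk0 c hc)]
  have hmem : ∀ {u}, u ∈ A₀ → affinePoint F u ∈ A := fun hu => (hA.ge ⟨_, hu, rfl⟩).1
  ext P
  constructor
  · rintro ⟨Q, ⟨a, ha, hQ⟩, rfl⟩
    by_cases haX : a ∈ points (atInfinity F (K ∙ x₀))
    · exact Or.inl (hX Q (hQ.trans (sup_le hpX haX)))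
    · obtain ⟨u, hu, rfl⟩ := hA.le ⟨ha, haX⟩
      rw [hp] at hQ
      obtain h | ⟨c, rfl⟩ := eq_of_le_sup_affinePoint hQ
      · exact Or.inl (hX Q (h.trans (hp ▸ hpX)))
      · exact Or.inr ⟨u, hu, c, toPG3_affinePoint _⟩
  · rintro (hP | ⟨u, hu, f, rfl⟩)
    · obtain ⟨u, hu⟩ := hne
      exact ⟨p, ⟨affinePoint F u, hmem hu, le_sup_left⟩, point_ext ((hX p hpX).trans hP.symm)⟩
    · refine ⟨affinePoint F (u + f • x₀), ⟨affinePoint F u, hmem hu, ?_⟩, toPG3_affinePoint _⟩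
      rw [hp]
      exact affinePoint_add_le _ _ _

end Functionals

/-! ### The blocking set is not planar -/

section NonPlanar

variable {F K U : Type*} [Field F] [Field K] [Algebra F K] [AddCommGroup U] [Module K U]
  [Module F U] {x₀ x₁ h₀ : U} {V₀ : Set U} {Λ : Fin 3 → Submodule F K}

theorem isNonPlanar_affineUnion [IsScalarTower F K U] (hK : Module.finrank F K = 3)
    (hx₁ : x₁ ≠ 0) (r₀ : U)
    (hΛ : ∀ i, Module.finrank F (Λ i) = 2) (hΛ0 : ∀ c, (∀ i, c ∈ Λ i) → c = 0) :
    IsNonPlanar (affinePoint F '' affineUnion V₀ r₀ h₀ x₁ Λ) := by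
  have : FiniteDimensional F K := Module.finite_of_finrank_pos (by omega)
  intro M hM hle
  have : FiniteDimensional F M := Module.finite_of_finrank_pos (by omega)
  have hmem : ∀ i, ∀ l ∈ Λ i, (h₀ + l • x₁, (1 : F)) ∈ M := fun i l hl =>
    affinePoint_mem_points.mp (hle ⟨_, Or.inr ⟨i, l, hl, rfl⟩, rfl⟩)
  have hh : (h₀, (1 : F)) ∈ M := by simpa using hmem 0 0 (Λ 0).zero_mem
  let g : (K × F) →ₗ[F] (U × F) :=
    (LinearMap.inl F U F ∘ₗ (LinearMap.toSpanSingleton K U x₁).restrictScalars F).coprod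
      (LinearMap.toSpanSingleton F (U × F) (h₀, 1))
  have hg : ∀ c a, g (c, a) = (c • x₁ + a • h₀, a) := fun c a => by simp [g]
  let N : Submodule F K := M.comap (g ∘ₗ LinearMap.inl F K F)
  have hN : ∀ i, Λ i ≤ N := by
    intro i l hl
    have := M.sub_mem (hmem i l hl) hh
    simpa [N, hg] using this
  -- the planes `Λ i` have no common vector, so they span the whole space
  have htop : N = ⊤ := by
    apply Submodule.eq_top_of_finrank_eq
    have h1 := Submodule.finrank_mono (hN 0)
    have h2 := N.finrank_le
    have h3 : Module.finrank F N ≠ 2 := by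
      intro h3
      have heq : ∀ i, Λ i = N := fun i =>
        Submodule.eq_of_le_of_finrank_eq (hN i) (by rw [hΛ i, h3])
      have hbot : N = ⊥ := (Submodule.eq_bot_iff _).mpr fun c hc =>
        hΛ0 c fun i => (heq i).symm ▸ hc
      rw [hbot, finrank_bot] at h3
      omega
    have := hΛ 0
    omega
  have hgM : ∀ x, g x ∈ M := by
    rintro ⟨c, a⟩
    have h1 : c ∈ N := htop ▸ Submodule.mem_top
    have h2 : g (c, a) = g (c, 0) + a • (h₀, (1 : F)) := by simp [hg]
    rw [h2]
    exact M.add_mem h1 (M.smul_mem a hh)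
  have hinj : Function.Injective (g.codRestrict M hgM) := by
    rw [LinearMap.injective_codRestrict_iff, injective_iff_map_eq_zero]
    rintro ⟨c, a⟩ h
    rw [hg, Prod.mk_eq_zero] at h
    obtain ⟨h1, rfl⟩ := h
    have : c = 0 := by simpa [hx₁] using h1
    rw [this]
    rfl
  have h1 := LinearMap.finrank_le_finrank_of_injective hinj
  rw [Module.finrank_prod, hK, Module.finrank_self, hM] at h1
  omega

theorem isNonPlanar_coneImage (hU : Module.finrank K U = 3) (r₀ : U)
    (hΛ : ∀ i, Module.finrank F (Λ i) = 2) {v : U} (hv : v ∈ V₀)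
    (hli : LinearIndependent K ![x₀, x₁, h₀ - v]) :
    IsNonPlanar (coneImage F x₀ (affineUnion V₀ r₀ h₀ x₁ Λ) : Set (ℙ K (U × K))) := by
  have : FiniteDimensional K U := Module.finite_of_finrank_pos (by omega)
  intro M hM hle
  have hmem : ∀ u ∈ affineUnion V₀ r₀ h₀ x₁ Λ, (u, (1 : K)) ∈ M := fun u hu =>
    affinePoint_mem_points.mp (hle (Or.inr ⟨u, hu, 0, by simp⟩))
  have hh : (h₀, (1 : K)) ∈ M := hmem _ (Or.inr ⟨0, 0, (Λ 0).zero_mem, by simp⟩)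
  have h0 : (x₀, (0 : K)) ∈ M :=
    (mk_mem_points (by simpa using hli.ne_zero 0)).mp
      (hle (Or.inl (Projectivization.submodule_mk ..)))
  have h1 : (x₁, (0 : K)) ∈ M := by
    obtain ⟨l, hl, hl0⟩ := (Submodule.ne_bot_iff (Λ 0)).mp (by
      intro h
      have := hΛ 0
      rw [h, finrank_bot] at this
      omega)
    have h2 := M.smul_mem l⁻¹ (M.sub_mem (hmem _ (Or.inr ⟨0, l, hl, rfl⟩)) hh)
    simpa [smul_smul, hl0] using h2
  have h2 : (h₀ - v, (0 : K)) ∈ M := by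
    simpa using M.sub_mem hh (hmem _ (Or.inl ⟨v, hv, 0, by simp⟩))
  have htop : M.comap (LinearMap.inl K U K) = ⊤ := by
    rw [eq_top_iff, ← hli.span_eq_top_of_card_eq_finrank (by simp [hU]), Submodule.span_le]
    rintro _ ⟨i, rfl⟩
    fin_cases i
    exacts [h0, h1, h2]
  have hMtop : M = ⊤ := by
    rw [eq_top_iff]
    rintro ⟨u, a⟩ -
    have h3 : (u - a • h₀, (0 : K)) ∈ M :=
      (htop ▸ Submodule.mem_top : u - a • h₀ ∈ M.comap (LinearMap.inl K U K))
    simpa using M.add_mem h3 (M.smul_mem a hh)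
  rw [hMtop, finrank_top, Module.finrank_prod, hU, Module.finrank_self] at hM
  omega

end NonPlanar

/-! ### Coordinates for the configuration -/

section Configuration

variable {F K U : Type*} [Field F] [Field K] [Algebra F K] [AddCommGroup U] [Module K U]
  [Module F U] [IsScalarTower F K U]

/-- A vector of `U × F` representing a point of the spread element `K x` is a multiple of `x`. -/
theorem exists_submodule_eq_span_smul {x : U} {P : ℙ F (U × F)}
    (hP : P ∈ points (atInfinity F (K ∙ x))) :
    ∃ c : K, c ≠ 0 ∧ P.submodule = F ∙ (c • x, (0 : F)) := by
  obtain ⟨⟨u, a⟩, h0, h⟩ := exists_submodule_eq_span P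
  rw [mem_points, h, Submodule.span_singleton_le_iff_mem, mem_atInfinity] at hP
  obtain ⟨h1, h2⟩ := hP
  obtain rfl : a = 0 := h2
  obtain ⟨c, rfl⟩ := Submodule.mem_span_singleton.mp h1
  exact ⟨c, by rintro rfl; simp at h0, h⟩

/-- A spread element is generated by any of its points. -/
theorem exists_eq_atInfinity_span {X : Submodule F (U × F)} (hX : X ∈ spread F K U)
    {P : ℙ F (U × F)} (hP : P ∈ points X) :
    ∃ x : U, x ≠ 0 ∧ P.submodule = F ∙ (x, (0 : F)) ∧ X = atInfinity F (K ∙ x) := by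
  obtain ⟨Y, hY, rfl⟩ := hX
  obtain ⟨⟨x, a⟩, h0, h⟩ := exists_submodule_eq_span P
  rw [mem_points, h, Submodule.span_singleton_le_iff_mem, mem_atInfinity] at hP
  obtain ⟨h1, h2⟩ := hP
  obtain rfl : a = 0 := h2
  have hx : x ≠ 0 := by rintro rfl; simp at h0
  refine ⟨x, hx, h, ?_⟩
  have : FiniteDimensional K Y := Module.finite_of_finrank_pos (by omega)
  rw [Submodule.eq_of_le_of_finrank_eq ((Submodule.span_singleton_le_iff_mem _ _).mpr h1)
    (by rw [finrank_span_singleton hx, hY])]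

/-- A functional whose kernel is spanned by the first two of three independent vectors. -/
theorem exists_functional_ker (hK : Module.finrank F K = 3) {ρ θ : K}
    (hli : LinearIndependent F ![1, ρ, θ]) :
    ∃ χ : K →ₗ[F] F, (∀ c, χ c = 0 ↔ ∃ a b : F, c = algebraMap F K a + b • ρ) ∧ χ θ ≠ 0 := by
  let B := basisOfLinearIndependentOfCardEqFinrank hli (by simp [hK])
  have hB : ∀ i, B i = ![1, ρ, θ] i := fun i => by simp [B]
  have h0 : B.coord 2 1 = 0 := by
    have : (1 : K) = B 0 := by simp [hB]
    rw [this, B.coord_apply, B.repr_self]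
    simp
  have h1 : B.coord 2 ρ = 0 := by
    have : ρ = B 1 := by simp [hB]
    rw [this, B.coord_apply, B.repr_self]
    simp
  refine ⟨B.coord 2, fun c => ⟨fun h => ?_, ?_⟩, ?_⟩
  · refine ⟨B.repr c 0, B.repr c 1, ?_⟩
    have h2 := B.sum_repr c
    rw [Fin.sum_univ_three, show B.repr c 2 = 0 from h, hB, hB] at h2
    simpa [Algebra.smul_def] using h2.symm
  · rintro ⟨a, b, rfl⟩
    rw [Algebra.algebraMap_eq_smul_one, map_add, map_smul, map_smul, h0, h1]
    simp
  · have : θ = B 2 := by simp [hB]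
    rw [this, B.coord_apply, B.repr_self]
    simp

/-- The points of the cone over the modified Baer subplane that are not on `X`. The base consists
of `q̃` and of affine points, and the line joining `r` and `q̃` is contained in `X`. -/
theorem mem_barB_diff_iff {X : Submodule F (U × F)} {r qt s : ℙ F (U × F)}
    {V : Set (ℙ F (U × F))} {L : Submodule F (U × F)} {r₀ : U}
    (hX : X ≤ infinity F U) (hr : r.submodule = F ∙ (r₀, (0 : F))) (hrX : r.submodule ≤ X)
    (hqX : qt.submodule ≤ X)
    (haff : ∀ P ∈ (V \ points L) ∪ {s}, P ≠ qt → ∃ v, P = affinePoint F v) {P : ℙ F (U × F)} :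
    P ∈ barB r V L s ∧ P ∉ points X ↔
      ∃ v ∈ {v | affinePoint F v ∈ (V \ points L) ∪ {s}}, ∃ c : F,
        P = affinePoint F (v + c • r₀) := by
  constructor
  · rintro ⟨⟨Q, hQ, hPQ⟩, hPX⟩
    have hQq : Q ≠ qt := by
      rintro rfl
      exact hPX (hPQ.trans (sup_le hrX hqX))
    obtain ⟨v, rfl⟩ := haff Q hQ hQq
    rw [hr] at hPQ
    obtain h | ⟨c, rfl⟩ := eq_of_le_sup_affinePoint hPQ
    · exact absurd (h.trans (hr ▸ hrX)) hPX
    · exact ⟨v, hQ, c, rfl⟩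
  · rintro ⟨v, hv, c, rfl⟩
    refine ⟨⟨_, hv, ?_⟩, fun h => affinePoint_notMem_infinity _ (le_trans h hX)⟩
    rw [hr]
    exact affinePoint_add_le _ _ _

theorem mem_tildeB_iff (h₀ : U) {x₁ : U} (hx₁ : x₁ ≠ 0)
    {L' : Fin 3 → Submodule F (U × F)} {Λ : Fin 3 → Submodule F K}
    (hLΛ : ∀ i c, c ∈ Λ i ↔ (c • x₁, (0 : F)) ∈ L' i)
    (hL'X' : ∀ i, L' i ≤ atInfinity F (K ∙ x₁)) (hΛ : ∀ i, Module.finrank F (Λ i) = 2)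
    {P : ℙ F (U × F)} :
    P ∈ tildeB (affinePoint F h₀) L' ↔ ∃ i, ∃ l ∈ Λ i, P = affinePoint F (h₀ + l • x₁) := by
  have key : ∀ i, ∀ l ∈ Λ i, l ≠ 0 → ∀ f : F,
      affinePoint F (h₀ + (f • l) • x₁) ∈ tildeB (affinePoint F h₀) L' := by
    intro i l hl hl0 f
    refine ⟨⟨Projectivization.mk F (l • x₁, 0) (by simp [hl0, hx₁]), ?_, ?_⟩,
      affinePoint_notMem_infinity _⟩
    · exact Set.mem_iUnion.mpr ⟨i, (mk_mem_points _).mpr ((hLΛ i l).mp hl)⟩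
    · rw [Projectivization.submodule_mk, sup_comm, smul_assoc]
      exact affinePoint_add_le _ _ _
  constructor
  · rintro ⟨⟨Q, hQ, hPQ⟩, hP⟩
    obtain ⟨i, hQi⟩ := Set.mem_iUnion.mp hQ
    obtain ⟨c, hc, hQc⟩ := exists_submodule_eq_span_smul (le_trans hQi (hL'X' i))
    rw [sup_comm, hQc] at hPQ
    rw [mem_points, hQc, Submodule.span_singleton_le_iff_mem, ← hLΛ] at hQi
    obtain h | ⟨f, rfl⟩ := eq_of_le_sup_affinePoint hPQ
    · exact absurd (h.trans (by
        rw [Submodule.span_singleton_le_iff_mem, mem_infinity])) hP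
    · exact ⟨i, f • c, (Λ i).smul_mem f hQi, by rw [smul_assoc]⟩
  · rintro ⟨i, l, hl, rfl⟩
    by_cases hl0 : l = 0
    · obtain ⟨c, hc, hc0⟩ := (Submodule.ne_bot_iff (Λ i)).mp (by
        intro h
        have := hΛ i
        rw [h, finrank_bot] at this
        omega)
      simpa [hl0] using key i c hc hc0 0
    · simpa using key i l hl hl0 1

/-- If `c⁻¹ = a + b ρ`, the point `c t` of `X'` is exceptional: a spread element `Z` with
`c t ∈ ⟨p, Z⟩` contains `c t - f p` for some scalar `f`, hence also the multiple
`t - f (a + b ρ) p` of it, and modulo `p` this is the point `t - f b r` of the line `tr`. -/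
theorem mem_exceptionalPoints {x₀ x₁ : U} {p t r : ℙ F (U × F)} {ρ c : K}
    (hli : LinearIndependent K ![x₀, x₁])
    (hp : p.submodule = F ∙ (x₀, (0 : F))) (ht : t.submodule = F ∙ (x₁, (0 : F)))
    (hr : r.submodule = F ∙ (ρ • x₀, (0 : F))) (hc : (c • x₁, (0 : F)) ≠ 0)
    (hct : Projectivization.mk F (c • x₁, (0 : F)) hc ≠ t) {a b : F}
    (hab : c⁻¹ = algebraMap F K a + b • ρ) :
    Projectivization.mk F (c • x₁, (0 : F)) hc ∈
      exceptionalPoints F K U (atInfinity F (K ∙ x₀)) (atInfinity F (K ∙ x₁)) p t r := by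
  refine ⟨?_, hct, ?_⟩
  · rw [mk_mem_points, mem_atInfinity]
    exact ⟨Submodule.smul_mem _ _ (Submodule.mem_span_singleton_self _), rfl⟩
  · rintro Z ⟨Y, hY, rfl⟩ - hy
    have hc0 : c ≠ 0 := by
      rintro rfl
      simp at hc
    rw [mk_mem_points, hp] at hy
    obtain ⟨w, hw, ⟨z, d⟩, hz, h⟩ := Submodule.mem_sup.mp hy
    obtain ⟨f, rfl⟩ := Submodule.mem_span_singleton.mp hw
    have hzY := (mem_atInfinity.mp hz).1
    have h1 : f • x₀ + z = c • x₁ := by simpa using congrArg Prod.fst h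
    have h2 : c⁻¹ • z = x₁ - f • (algebraMap F K a + b • ρ) • x₀ := by
      rw [eq_sub_of_add_eq' h1, smul_sub, inv_smul_smul₀ hc0, hab, smul_comm]
    have hne : (x₁ + (-(f * b)) • ρ • x₀, (0 : F)) ≠ 0 := by
      intro h3
      have h4 : x₁ + (-(f * b)) • ρ • x₀ = 0 := congrArg Prod.fst h3
      have h5 := (LinearIndependent.pair_iff.mp hli (algebraMap F K (-(f * b)) * ρ) 1 (by
        rw [one_smul, mul_smul, algebraMap_smul, add_comm]
        exact h4)).2
      exact one_ne_zero h5
    refine ⟨Projectivization.mk F _ hne, ?_, ?_⟩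
    · rw [mk_mem_points, hp]
      refine Submodule.mem_sup.mpr ⟨(f * a) • (x₀, 0), Submodule.smul_mem _ _
        (Submodule.mem_span_singleton_self _), (c⁻¹ • z, 0),
        mem_atInfinity.mpr ⟨Y.smul_mem _ hzY, rfl⟩, ?_⟩
      rw [h2, Prod.ext_iff]
      simp only [Prod.smul_mk, smul_zero, Prod.mk_add_mk, add_zero, and_true]
      rw [add_smul, smul_add, algebraMap_smul, smul_smul f a, smul_assoc b ρ, smul_smul f b,
        neg_smul]
      abel
    · rw [mk_mem_points, ht, hr]
      refine Submodule.mem_sup.mpr ⟨(x₁, 0), Submodule.mem_span_singleton_self _,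
        (-(f * b)) • (ρ • x₀, 0), Submodule.smul_mem _ _ (Submodule.mem_span_singleton_self _), ?_⟩
      simp

end Configuration

end BarlottiCofman

/-! ### Minimality and nonplanarity of the blocking sets -/

open BarlottiCofman in
theorem theorem7
    {k F K U : Type*} [Field k] [Field F] [Field K] [Finite k] [Finite F] [Finite K]
    [Algebra k F] [Algebra F K] [AddCommGroup U] [Module K U] [Module F U] [IsScalarTower F K U]
    (q : ℕ) (hk : Nat.card k = q) (hF : Nat.card F = q ^ 2) (hK : Nat.card K = q ^ 6)
    (hU : Module.finrank K U = 3)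
    -- two spread elements and a point of the first one
    (X X' : Submodule F (U × F)) (hX : X ∈ BarlottiCofman.spread F K U)
    (hX' : X' ∈ BarlottiCofman.spread F K U)
    (p : ℙ F (U × F)) (hp : p ∈ BarlottiCofman.points X)
    -- the subspaces `Γ` (dimension 7) and `Γ'` (dimension 8)
    (Γ Γ' : Submodule F (U × F)) (hΓdim : Module.finrank F Γ = 8)
    (hΓ : Γ ≤ BarlottiCofman.infinity F U) (hX'Γ : X' ≤ Γ) (hpΓ : p ∉ BarlottiCofman.points Γ)
    (hΓ'dim : Module.finrank F Γ' = 9) (hΓ' : Γ' ⊓ BarlottiCofman.infinity F U = Γ)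
    -- the line `Γ ∩ X` is spanned by `r` and `qt`
    (r qt : ℙ F (U × F)) (hΘ : Γ ⊓ X = r.submodule ⊔ qt.submodule)
    -- the plane `π` of `Γ'`, and its Baer subplane `V`
    (t : ℙ F (U × F)) (ht : t ∈ BarlottiCofman.points X')
    (π : Submodule F (U × F)) (hπdim : Module.finrank F π = 3) (hπ : π ≤ Γ')
    (hπinf : π ⊓ BarlottiCofman.infinity F U = t.submodule ⊔ qt.submodule)
    (V : Set (ℙ F (U × F))) (hV : BarlottiCofman.IsBaerSubplane k π V)
    (hVinf : V ∩ BarlottiCofman.points (t.submodule ⊔ qt.submodule) = {qt})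
    -- a real line `L` of `π` through `t`, and a point `s` of `V` on it
    (L : Submodule F (U × F)) (hLdim : Module.finrank F L = 2) (hLπ : L ≤ π)
    (htL : t ∈ BarlottiCofman.points L) (hLreal : (V ∩ BarlottiCofman.points L).ncard = q + 1)
    (s : ℙ F (U × F)) (hs : s ∈ V ∩ BarlottiCofman.points L)
    -- three lines of `X'` without a common point
    (L' : Fin 3 → Submodule F (U × F)) (hL'dim : ∀ i, Module.finrank F (L' i) = 2)
    (hL'X' : ∀ i, L' i ≤ X') (hL'inter : ⋂ i, BarlottiCofman.points (L' i) = ∅)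
    (htL' : ∀ i, t ∉ BarlottiCofman.points (L' i))
    (htildeL' : ∀ i, ∀ y ∈ BarlottiCofman.exceptionalPoints F K U X X' p t r,
      y ∉ BarlottiCofman.points (L' i))
    -- the vertex `h`
    (h : ℙ F (U × F)) (hhΓ' : h ∈ BarlottiCofman.points Γ')
    (hhinf : h ∉ BarlottiCofman.points (BarlottiCofman.infinity F U))
    (hh : h ∉ BarlottiCofman.points (X ⊔ X' ⊔ BarlottiCofman.spanPoints V)) :
    BarlottiCofman.barB r V L s ∪ BarlottiCofman.tildeB h L' ⊆ BarlottiCofman.points Γ' ∧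
    BarlottiCofman.IsMinimalBlocking (BarlottiCofman.familyH F K U X p)
      ((BarlottiCofman.barB r V L s ∪ BarlottiCofman.tildeB h L') \ BarlottiCofman.points X) ∧
    BarlottiCofman.IsNonPlanar
      ((BarlottiCofman.barB r V L s ∪ BarlottiCofman.tildeB h L') \ BarlottiCofman.points X) ∧
    BarlottiCofman.IsMinimalBlocking (BarlottiCofman.planes K (U × K))
      (BarlottiCofman.toPG3 F K U ''
        BarlottiCofman.cone p (BarlottiCofman.barB r V L s ∪ BarlottiCofman.tildeB h L')) ∧
    BarlottiCofman.IsNonPlanar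
      (BarlottiCofman.toPG3 F K U ''
        BarlottiCofman.cone p (BarlottiCofman.barB r V L s ∪ BarlottiCofman.tildeB h L')) := by
  -- the degrees of the field extensions
  have hq2 : 2 ≤ q := hk ▸ Finite.one_lt_card
  have hFk : Module.finrank k F = 2 := by
    have h1 := Module.natCard_eq_pow_finrank (K := k) (V := F)
    rw [hF, hk] at h1
    exact (Nat.pow_right_injective hq2 h1).symm
  have hKF : Module.finrank F K = 3 := by
    have h1 := Module.natCard_eq_pow_finrank (K := F) (V := K)
    rw [hF, hK, ← pow_mul] at h1
    have := Nat.pow_right_injective hq2 h1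
    omega
  have hF4 : 4 ≤ Nat.card F := by
    rw [hF]
    exact Nat.pow_le_pow_left hq2 2
  have : FiniteDimensional K U := Module.finite_of_finrank_pos (by omega)
  have : FiniteDimensional F K := Module.finite_of_finrank_pos (by omega)
  have : FiniteDimensional F U := Module.Finite.trans K U
  -- coordinates
  obtain ⟨x₀, hx₀, hp₀, rfl⟩ := exists_eq_atInfinity_span hX hp
  obtain ⟨x₁, hx₁, ht₁, rfl⟩ := exists_eq_atInfinity_span hX' ht
  have hrΘ : r.submodule ≤ Γ ⊓ atInfinity F (K ∙ x₀) := hΘ ▸ le_sup_left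
  have hqΘ : qt.submodule ≤ Γ ⊓ atInfinity F (K ∙ x₀) := hΘ ▸ le_sup_right
  obtain ⟨ρ, hρ0, hr₀⟩ := exists_submodule_eq_span_smul
    (mem_points.mpr (hrΘ.trans inf_le_right))
  obtain ⟨θ, hθ0, hq₀⟩ := exists_submodule_eq_span_smul
    (mem_points.mpr (hqΘ.trans inf_le_right))
  have hpΓ' : (x₀, (0 : F)) ∉ Γ := by
    rwa [mem_points, hp₀, Submodule.span_singleton_le_iff_mem] at hpΓ
  have hrq : r ≠ qt := by
    rintro rfl
    rw [sup_idem] at hΘ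
    have h1 := Submodule.finrank_sup_add_finrank_inf_eq Γ (atInfinity F (K ∙ x₀))
    rw [hΘ, r.finrank_submodule, hΓdim, finrank_atInfinity, hKF, finrank_span_singleton hx₀] at h1
    have h2 := Submodule.finrank_mono (sup_le hΓ (atInfinity_le_infinity (F := F) (K ∙ x₀)))
    rw [infinity, LinearMap.finrank_range_of_inj LinearMap.inl_injective,
      finrank_eq_nine hU hKF] at h2
    omega
  have hli2 : LinearIndependent K ![x₀, x₁] := by
    rw [LinearIndependent.pair_symm_iff, LinearIndependent.pair_iff' hx₁]
    intro c hc
    refine hpΓ' (hX'Γ (mem_atInfinity.mpr ⟨?_, rfl⟩))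
    exact Submodule.mem_span_singleton.mpr ⟨c, hc⟩
  have htq : t ≠ qt := by
    rintro rfl
    have h1 : (θ • x₀, (0 : F)) ∈ F ∙ (x₁, (0 : F)) := by
      rw [← ht₁, hq₀]
      exact Submodule.mem_span_singleton_self _
    obtain ⟨c, hc⟩ := Submodule.mem_span_singleton.mp h1
    have h2 : c • x₁ = θ • x₀ := congrArg Prod.fst hc
    have h3 := (LinearIndependent.pair_iff.mp hli2 θ (-algebraMap F K c) (by
      rw [neg_smul, algebraMap_smul, h2]; exact add_neg_cancel _)).1
    exact hθ0 h3
  -- `p` is not on the line `r q̃`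
  have hliF : LinearIndependent F ![1, ρ, θ] := by
    rw [Fintype.linearIndependent_iff]
    intro g hg
    simp only [Fin.sum_univ_three, Matrix.cons_val_zero, Matrix.cons_val_one,
      Matrix.cons_val] at hg
    have hrΓ : (ρ • x₀, (0 : F)) ∈ Γ := by
      rw [← Submodule.span_singleton_le_iff_mem, ← hr₀]
      exact hrΘ.trans inf_le_left
    have hqΓ : (θ • x₀, (0 : F)) ∈ Γ := by
      rw [← Submodule.span_singleton_le_iff_mem, ← hq₀]
      exact hqΘ.trans inf_le_left
    have h0 : g 0 = 0 := by
      by_contra h0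
      apply hpΓ'
      rw [← Γ.smul_mem_iff h0]
      have h1 := Γ.neg_mem (Γ.add_mem (Γ.smul_mem (g 1) hrΓ) (Γ.smul_mem (g 2) hqΓ))
      have h2 := congrArg (· • x₀) hg
      simp only [add_smul, smul_assoc, one_smul, zero_smul] at h2
      convert h1 using 1
      rw [Prod.ext_iff]
      simp only [Prod.smul_mk, smul_zero, Prod.mk_add_mk, add_zero, Prod.neg_mk, neg_zero, and_true]
      rw [eq_neg_iff_add_eq_zero, ← add_assoc]
      exact h2
    rw [h0, zero_smul, zero_add] at hg
    have h1 : g 1 = 0 := by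
      by_contra h1
      apply hrq
      apply point_eq_of_le
      rw [hr₀, hq₀, Submodule.span_singleton_le_iff_mem, Submodule.mem_span_singleton]
      refine ⟨-((g 1)⁻¹ * g 2), ?_⟩
      have h2 : ρ = -((g 1)⁻¹ * g 2) • θ := by
        rw [neg_smul, mul_smul, ← smul_neg, ← eq_neg_of_add_eq_zero_left hg, inv_smul_smul₀ h1]
      rw [Prod.smul_mk, smul_zero, ← smul_assoc, ← h2]
    rw [h1, zero_smul, zero_add] at hg
    have h2 : g 2 = 0 := (smul_eq_zero.mp hg).resolve_right hθ0
    intro i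
    fin_cases i
    exacts [h0, h1, h2]
  obtain ⟨χ, hχ, hχθ⟩ := exists_functional_ker hKF hliF
  have hρ : ∀ a : F, ρ ≠ algebraMap F K a := by
    intro a h
    have h1 := Fintype.linearIndependent_iff.mp hliF ![-a, 1, 0] (by
      simp [Fin.sum_univ_three, h, Algebra.algebraMap_eq_smul_one]) 1
    exact one_ne_zero h1
  obtain ⟨h₀, rfl⟩ := exists_eq_affinePoint hhinf
  -- the lines of `X'` as planes of the extension field
  let ι : K →ₗ[F] (U × F) :=
    LinearMap.inl F U F ∘ₗ (LinearMap.toSpanSingleton K U x₁).restrictScalars F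
  have hι : ∀ c, ι c = (c • x₁, 0) := fun c => by simp [ι]
  have hιinj : Function.Injective ι := by
    rw [injective_iff_map_eq_zero]
    intro c hc
    rw [hι] at hc
    exact (smul_eq_zero.mp (congrArg Prod.fst hc)).resolve_right hx₁
  let Λ : Fin 3 → Submodule F K := fun i => (L' i).comap ι
  have hLΛ : ∀ i c, c ∈ Λ i ↔ (c • x₁, (0 : F)) ∈ L' i := fun i c => by
    rw [← hι]; rfl
  have hΛ : ∀ i, Module.finrank F (Λ i) = 2 := by
    intro i
    have h1 : (Λ i).map ι = L' i := by
      apply Submodule.map_comap_eq_self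
      intro x hx
      obtain ⟨h2, h3⟩ := mem_atInfinity.mp (hL'X' i hx)
      obtain ⟨c, hc⟩ := Submodule.mem_span_singleton.mp h2
      exact ⟨c, by rw [hι, hc, ← h3]⟩
    rw [(Submodule.equivMapOfInjective ι hιinj (Λ i)).finrank_eq, h1, hL'dim]
  have hne : ∀ c : K, c ≠ 0 → (c • x₁, (0 : F)) ≠ 0 := by
    intro c hc h
    exact hc ((smul_eq_zero.mp (congrArg Prod.fst h)).resolve_right hx₁)
  have hΛ0 : ∀ c, (∀ i, c ∈ Λ i) → c = 0 := by
    intro c hc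
    by_contra hc0
    have : Projectivization.mk F (c • x₁, (0 : F)) (hne c hc0) ∈ ⋂ i, points (L' i) :=
      Set.mem_iInter.mpr fun i => (mk_mem_points _).mpr ((hLΛ i c).mp (hc i))
    rw [hL'inter] at this
    exact this
  have hχΛ : ∀ i, ∀ c ∈ Λ i, c ≠ 0 → χ c⁻¹ ≠ 0 := by
    intro i c hc hc0 h
    have hmem : Projectivization.mk F (c • x₁, (0 : F)) (hne c hc0) ∈ points (L' i) :=
      (mk_mem_points _).mpr ((hLΛ i c).mp hc)
    obtain ⟨a, b, hab⟩ := (hχ _).mp h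
    refine htildeL' i _ (mem_exceptionalPoints hli2 hp₀ ht₁ hr₀ (hne c hc0) ?_ hab) hmem
    intro heq
    exact htL' i (heq ▸ hmem)
  -- the points of the Baer subplane
  have hVaff : ∀ P ∈ V, P ≠ qt → ∃ v, P = affinePoint F v := by
    intro P hP hPq
    refine exists_eq_affinePoint fun h => hPq ?_
    rw [← Set.mem_singleton_iff, ← hVinf]
    refine ⟨hP, mem_points.mpr ?_⟩
    rw [← hπinf]
    exact le_inf (hV.submodule_le hP) h
  have hVW : ∀ P ∈ (V \ points L) ∪ {s}, P ∈ V := by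
    rintro P (h | rfl)
    exacts [h.1, hs.1]
  have hqL : qt ∉ points L := by
    intro h
    have hL : L = t.submodule ⊔ qt.submodule := (sup_eq_of_mem_line htq hLdim htL h).symm
    rw [hL, hVinf, Set.ncard_singleton] at hLreal
    omega
  have hli : ∀ v, affinePoint F v ∈ V → LinearIndependent K ![x₀, x₁, h₀ - v] := by
    intro v hv
    rw [Fintype.linearIndependent_iff]
    intro g hg
    simp only [Fin.sum_univ_three, Matrix.cons_val_zero, Matrix.cons_val_one,
      Matrix.cons_val] at hg
    have h2 : g 2 = 0 := by
      by_contra h2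
      apply hh
      rw [affinePoint_mem_points]
      have h3 : h₀ = -((g 2)⁻¹ * g 0) • x₀ + -((g 2)⁻¹ * g 1) • x₁ + v := by
        have h4 : h₀ - v = -((g 2)⁻¹ * g 0) • x₀ + -((g 2)⁻¹ * g 1) • x₁ := by
          rw [← inv_smul_smul₀ h2 (h₀ - v), eq_neg_of_add_eq_zero_right hg, smul_neg, smul_add,
            smul_smul, smul_smul, neg_smul, neg_smul]
          abel
        rw [← h4, sub_add_cancel]
      have h5 : (h₀, (1 : F)) =
          (-((g 2)⁻¹ * g 0) • x₀, 0) + (-((g 2)⁻¹ * g 1) • x₁, 0) + (v, 1) := by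
        rw [Prod.ext_iff]
        simpa using h3
      rw [h5]
      refine Submodule.add_mem_sup (Submodule.add_mem_sup ?_ ?_) ?_
      · exact mem_atInfinity.mpr
          ⟨Submodule.smul_mem _ _ (Submodule.mem_span_singleton_self _), rfl⟩
      · exact mem_atInfinity.mpr
          ⟨Submodule.smul_mem _ _ (Submodule.mem_span_singleton_self _), rfl⟩
      · rw [← affinePoint_mem_points]
        exact le_iSup₂_of_le (f := fun P (_ : P ∈ V) => P.submodule) _ hv le_rfl
    rw [h2, zero_smul, add_zero] at hg
    obtain ⟨h0, h1⟩ := LinearIndependent.pair_iff.mp hli2 _ _ hg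
    intro i
    fin_cases i
    exacts [h0, h1, h2]
  -- translation of the properties of the modified Baer subplane
  let V₀ : Set U := {v | affinePoint F v ∈ (V \ points L) ∪ {s}}
  have htker : ∀ f : (U × F) →ₗ[F] F, f (x₁, 0) = 0 → t ∈ points (LinearMap.ker f) := by
    intro f hf
    rwa [mem_points, ht₁, Submodule.span_singleton_le_iff_mem]
  have hqker : ∀ f : (U × F) →ₗ[F] F, f (θ • x₀, 0) ≠ 0 → qt ∉ points (LinearMap.ker f) := by
    intro f hf
    rwa [mem_points, hq₀, Submodule.span_singleton_le_iff_mem]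
  have hblock : ∀ f : (U × F) →ₗ[F] F, f (x₁, 0) = 0 → f (θ • x₀, 0) ≠ 0 →
      ∃ v ∈ V₀, f (v, 1) = 0 := by
    intro f hft hfq
    obtain ⟨P, hP, hPf⟩ := hV.exists_mem_diff_union_mem_ker hFk hVinf htq hLdim htL hs.2 f
      (htker f hft)
    obtain ⟨v, rfl⟩ := hVaff P (hVW P hP) (by rintro rfl; exact hqker f hfq hPf)
    exact ⟨v, hP, affinePoint_mem_points.mp hPf⟩
  have huniq : ∀ f : (U × F) →ₗ[F] F, f (x₁, 0) = 0 → f (θ • x₀, 0) ≠ 0 →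
      ∀ v ∈ V₀, ∀ v' ∈ V₀, f (v, 1) = 0 → f (v', 1) = 0 → v = v' := by
    intro f hft hfq v hv v' hv' hfv hfv'
    exact affinePoint_injective (hV.eq_of_mem_diff_union_of_mem_ker hπdim hVinf htq hLdim htL hLπ
      hs (Set.exists_ne_of_one_lt_ncard (by omega) s) f (htker f hft) (hqker f hfq) hv hv'
      (affinePoint_mem_points.mpr hfv) (affinePoint_mem_points.mpr hfv'))
  have htan : ∀ e : F, e ≠ 0 → ∃ v, LinearIndependent K ![x₀, x₁, h₀ - v] ∧
      ∀ f : (U × F) →ₗ[F] F, f (θ • x₀, 0) ≠ 0 → f (x₁, 0) = e * f (θ • x₀, 0) → f (v, 1) = 0 →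
        ∀ v' ∈ V₀, f (v', 1) ≠ 0 := by
    intro e he
    -- the point of the line `t q̃` in the kernels of all these functionals
    have hz : (x₁, (0 : F)) - e • (θ • x₀, (0 : F)) ≠ 0 := by
      intro h
      apply htq
      apply point_eq_of_le
      rw [ht₁, hq₀, Submodule.span_singleton_le_iff_mem, sub_eq_zero.mp h]
      exact Submodule.smul_mem _ _ (Submodule.mem_span_singleton_self _)
    have htm : (x₁, (0 : F)) ∈ t.submodule := ht₁ ▸ Submodule.mem_span_singleton_self _
    have hqm : (θ • x₀, (0 : F)) ∈ qt.submodule := hq₀ ▸ Submodule.mem_span_singleton_self _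
    have hu : Projectivization.mk F _ hz ∈ points (t.submodule ⊔ qt.submodule) :=
      (mk_mem_points hz).mpr (Submodule.sub_mem _ (Submodule.mem_sup_left htm)
        (Submodule.smul_mem _ e (Submodule.mem_sup_right hqm)))
    have hut : Projectivization.mk F _ hz ≠ t := by
      intro h
      have h1 : (x₁, (0 : F)) - e • (θ • x₀, (0 : F)) ∈ t.submodule :=
        (mk_mem_points hz).mp (by rw [h]; exact le_rfl (a := t.submodule))
      have h2 : (θ • x₀, (0 : F)) ∈ t.submodule :=
        (Submodule.smul_mem_iff _ he).mp ((Submodule.sub_mem_iff_right _ htm).mp h1)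
      refine htq (point_eq_of_le ?_).symm
      rwa [hq₀, Submodule.span_singleton_le_iff_mem]
    have huq : Projectivization.mk F _ hz ≠ qt := by
      intro h
      have h1 : (x₁, (0 : F)) - e • (θ • x₀, (0 : F)) ∈ qt.submodule :=
        (mk_mem_points hz).mp (by rw [h]; exact le_rfl (a := qt.submodule))
      have h2 : (x₁, (0 : F)) ∈ qt.submodule :=
        (Submodule.sub_mem_iff_left _ (Submodule.smul_mem _ e hqm)).mp h1
      refine htq (point_eq_of_le ?_)
      rwa [ht₁, Submodule.span_singleton_le_iff_mem]
    obtain ⟨P, ⟨hPV, hPL⟩, hP⟩ := hV.exists_tangent_line hπdim hVinf htq hLdim htL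
      (hπinf ▸ inf_le_left) hs.1 (by omega) hu hut huq
    obtain ⟨v, rfl⟩ := hVaff P hPV (by rintro rfl; exact hqL hPL)
    refine ⟨v, hli v hPV, fun f hfq hft hfv v' hv' hfv' => ?_⟩
    refine hP f (hqker f hfq) ((mk_mem_points hz).mpr ?_) (affinePoint_mem_points.mpr hfv) _ hv'
      (affinePoint_mem_points.mpr hfv')
    rw [LinearMap.mem_ker, map_sub, map_smul, hft, smul_eq_mul, sub_self]
  -- the points outside `X` are all affine
  have hset : (barB r V L s ∪ tildeB (affinePoint F h₀) L') \ points (atInfinity F (K ∙ x₀)) =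
      affinePoint F '' affineUnion V₀ (ρ • x₀) h₀ x₁ Λ := by
    have hXinf := atInfinity_le_infinity (F := F) (K ∙ x₀)
    have h1 := fun P => mem_barB_diff_iff (P := P) hXinf hr₀ (hrΘ.trans inf_le_right)
      (hqΘ.trans inf_le_right) fun P hP hPq => hVaff P (hVW P hP) hPq
    have h2 := fun P => mem_tildeB_iff (P := P) h₀ hx₁ hLΛ hL'X' hΛ
    ext P
    constructor
    · rintro ⟨hP | hP, hPX⟩
      · obtain ⟨v, hv, c, rfl⟩ := (h1 P).mp ⟨hP, hPX⟩
        exact ⟨_, Or.inl ⟨v, hv, c, rfl⟩, rfl⟩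
      · obtain ⟨i, l, hl, rfl⟩ := (h2 P).mp hP
        exact ⟨_, Or.inr ⟨i, l, hl, rfl⟩, rfl⟩
    · rintro ⟨_, ⟨v, hv, c, rfl⟩ | ⟨i, l, hl, rfl⟩, rfl⟩
      · have := (h1 _).mpr ⟨v, hv, c, rfl⟩
        exact ⟨Or.inl this.1, this.2⟩
      · exact ⟨Or.inr ((h2 _).mpr ⟨i, l, hl, rfl⟩),
          fun h => affinePoint_notMem_infinity _ (le_trans h hXinf)⟩
  obtain ⟨s₀, rfl⟩ := hVaff s hs.1 (by rintro rfl; exact hqL hs.2)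
  have hs₀ : s₀ ∈ V₀ := Or.inr rfl
  have hmeet := fun φ hφ κ => exists_mem_affineUnion (h₀ := h₀) hKF hχ hχθ hΛ hΛ0 hblock φ hφ κ
  have htangent := fun u hu => exists_tangent_affineUnion (u := u) hF4 hU hKF hχ hχθ hρ hΛ hΛ0 hχΛ
    (fun v hv => hli v (hVW _ hv)) huniq htan hu
  have himage := toPG3_image_cone hp₀ hset ⟨s₀, Or.inl ⟨s₀, hs₀, 0, by simp⟩⟩
  have hΓΓ' : Γ ≤ Γ' := hΓ' ▸ inf_le_left
  refine ⟨?_, ?_, ?_, ?_, ?_⟩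
  · rintro P (⟨Q, hQ, hPQ⟩ | ⟨⟨Q, hQ, hPQ⟩, -⟩)
    · exact hPQ.trans (sup_le (hrΘ.trans (inf_le_left.trans hΓΓ'))
        ((hV.submodule_le (hVW Q hQ)).trans hπ))
    · obtain ⟨i, hQi⟩ := Set.mem_iUnion.mp hQ
      exact hPQ.trans (sup_le hhΓ' (hQi.trans ((hL'X' i).trans (hX'Γ.trans hΓΓ'))))
  · rw [hset]
    exact isMinimalBlocking_familyH hU hKF hp₀ hmeet htangent
  · rw [hset]
    exact isNonPlanar_affineUnion hKF hx₁ _ hΛ hΛ0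
  · rw [himage]
    exact isMinimalBlocking_coneImage hU hx₀ hmeet htangent
  · rw [himage]
    exact isNonPlanar_coneImage hU _ hΛ hs₀ (hli s₀ hs.1)
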